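/- **Setting.** A tensor scheme $\mathcal D$ consists of a set $Ob(\mathcal D)$ and, for any two finite words $x_1\cdots x_m$, $y_1\cdots y_n$ in $Ob(\mathcal D)$ (the empty word $\varnothing$ included), a set $Mor_{\mathcal D}(x_1\cdots x_m,\,y_1\cdots y_n)$ of morphisms with source $x_1\cdots x_m$ and target $y_1\cdots y_n$. A morphism of tensor schemes is a map on objects together with a map on morphisms that respects sources and targets. $\mathbf{T.Sch}$ is the category of small tensor schemes; $\mathbf{Str.T}$ is the category of small strict tensor categories and strict tensor functors. The functor $U:\mathbf{Str.T}\to\mathbf{T.Sch}$ sends $\mathcal V$ to the tensor scheme with objects $Ob(\mathcal V)$ whose morphisms $x_1\cdots x_m\to y_1\cdots y_n$ are the morphisms $x_1\otimes\cdots\otimes x_m\to y_1\otimes\cdots\otimes y_n$ of $\mathcal V$ (prime diagrams in $\mathcal V$; the empty tensor product is the unit object). The functor $F:\mathbf{T.Sch}\to\mathbf{Str.T}$ sends $\mathcal D$ to the strict tensor category whose objects are the words in $Ob(\mathcal D)$ and whose morphisms are the progressive plane diagrams with edges labelled by objects and vertices labelled by morphisms of $\mathcal D$, up to deformation; composition is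 vertical stacking, and the tensor product is juxtaposition. $F$ is left adjoint to $U$; the unit sends $x$ to the one-letter word $x$ and a morphism to the one-vertex diagram that it labels, and the counit $\varepsilon_{\mathcal V}:FU(\mathcal V)\to\mathcal V$ sends a word to its tensor product and a diagram in $\mathcal V$ to its value. Let $T=UF$ be the resulting monad on $\mathbf{T.Sch}$, let $\mathbf{T.Sch}^T$ be its Eilenberg–Moore category, whose objects $(\mathcal D,\epsilon:T\mathcal D\to\mathcal D)$ are called tensor manifolds, and let $\Phi:\mathbf{Str.T}\to\mathbf{T.Sch}^T$, $\Phi(\mathcal V)=(U\mathcal V,\,U\varepsilon_{\mathcal V})$, be the comparison functor. **Theorem.** $\Phi$ is an embedding, that is, it is full, faithful and injective on objects. Moreover, the following rules define a functor $\Psi:\mathbf{T.Sch}^T\to\mathbf{Str.T}$. For a tensor manifold $(\mathcal D,\epsilon)$, with $\epsilon_o$ and $\epsilon_m$ the maps of $\epsilon$ on objects and on morphisms: * $Ob(\Psi(\mathcal D,\epsilon))=Ob(\mathcal D)$, and the morphisms $x\to y$ are the elements of $Mor_{\mathcal D}(x,y)$, where $x$ and $y$ are regarded as one-letter words; * the unit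 object is $\epsilon_o(\varnothing)$, and $x\otimes y=\epsilon_o(xy)$; * for $f:x\to y$ and $g:z\to w$, the morphism $f\otimes g$ is the value of $\epsilon_m$ at the diagram $xz\to yw$ with $f$ to the left of $g$, regarded as a morphism of $T\mathcal D$ whose source and target are the one-letter words with letters $xz$ and $yw$; * for $f:x\to y$ and $g:y\to z$, the composite $g\circ f$ is the value of $\epsilon_m$ at the diagram $x\to z$ with $f$ above $g$, regarded in the same way as a morphism from the one-letter word with letter $x$ to the one-letter word with letter $z$ (recall that $\epsilon_o(x)=x$ for one-letter words); * $Id_x$ is the value of $\epsilon_m$ at the diagram $x\to x$ without vertices; * on a morphism $\varphi$ of tensor manifolds, $\Psi(\varphi)$ is $\varphi$ on objects, and the restriction of $\varphi$ to the morphisms between one-letter words. That is, each $\Psi(\mathcal D,\epsilon)$ is a strict tensor category and each $\Psi(\varphi)$ is a strict tensor functor. Finally, $\Psi\circ\Phi\cong \mathrm{Id}_{\mathbf{Str.T}}$. -/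

import Mathlib

open CategoryTheory

universe u

namespace TensorCalculus

/-! ## Tensor schemes -/

/-- A (small) tensor scheme: a set of objects and, for any two finite words `x₁⋯xₘ`, `y₁⋯yₙ` in the
objects (the empty word is allowed), the set of morphisms with source `x₁⋯xₘ` and target `y₁⋯yₙ`. -/
structure TensorScheme where
  /-- objects -/
  Ob : Type u
  /-- morphisms with a given source word and a given target word -/
  Mor : List Ob → List Ob → Type u

namespace TensorScheme

/-- Transport of a morphism along equalities of words. -/
def castMor (D : TensorScheme.{u}) {xs ys xs' ys' : List D.Ob} (h : xs = xs') (h' : ys = ys')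
    (f : D.Mor xs ys) : D.Mor xs' ys' :=
  cast (by rw [h, h']) f

theorem castMor_heq (D : TensorScheme.{u}) {xs ys xs' ys' : List D.Ob} (h : xs = xs')
    (h' : ys = ys') (f : D.Mor xs ys) : HEq (D.castMor h h' f) f :=
  cast_heq _ _

/-- A morphism of tensor schemes: a map on objects and a map on morphisms, compatible with sources
and targets. -/
structure Hom (D E : TensorScheme.{u}) where
  /-- the map on objects -/
  obj : D.Ob → E.Ob
  /-- the map on morphisms -/
  mor : ∀ {xs ys : List D.Ob}, D.Mor xs ys → E.Mor (xs.map obj) (ys.map obj)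

namespace Hom

theorem ext_heq {D E : TensorScheme.{u}} {φ ψ : Hom D E} (h : ∀ x, φ.obj x = ψ.obj x)
    (h' : ∀ (xs ys : List D.Ob) (f : D.Mor xs ys), HEq (φ.mor f) (ψ.mor f)) : φ = ψ := by
  obtain ⟨o, m⟩ := φ
  obtain ⟨o', m'⟩ := ψ
  obtain rfl : o = o' := funext h
  congr
  funext xs ys f
  exact eq_of_heq (h' xs ys f)

theorem mor_heq {D E : TensorScheme.{u}} (φ : Hom D E) {xs ys xs' ys' : List D.Ob}
    (h : xs = xs') (h' : ys = ys') {f : D.Mor xs ys} {f' : D.Mor xs' ys'} (hf : HEq f f') :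
    HEq (φ.mor f) (φ.mor f') := by
  subst h h'
  rw [eq_of_heq hf]

/-- The identity morphism. -/
def id (D : TensorScheme.{u}) : Hom D D where
  obj x := x
  mor f := D.castMor (List.map_id' _).symm (List.map_id' _).symm f

/-- Composition of morphisms. -/
def comp {D E G : TensorScheme.{u}} (φ : Hom D E) (ψ : Hom E G) : Hom D G where
  obj x := ψ.obj (φ.obj x)
  mor f := G.castMor (by simp [Function.comp_def]) (by simp [Function.comp_def]) (ψ.mor (φ.mor f))

theorem id_mor_heq {D : TensorScheme.{u}} {xs ys : List D.Ob} (f : D.Mor xs ys) :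
    HEq ((Hom.id D).mor f) f := cast_heq _ _

theorem comp_mor_heq {D E G : TensorScheme.{u}} (φ : Hom D E) (ψ : Hom E G) {xs ys : List D.Ob}
    (f : D.Mor xs ys) : HEq ((φ.comp ψ).mor f) (ψ.mor (φ.mor f)) :=
  cast_heq _ _

theorem map_comp_obj {D E G : TensorScheme.{u}} (φ : Hom D E) (ψ : Hom E G) (xs : List D.Ob) :
    xs.map (φ.comp ψ).obj = (xs.map φ.obj).map ψ.obj :=
  (List.map_map (f := φ.obj) (g := ψ.obj)).symm

end Hom

/-- The category `T.Sch` of tensor schemes. -/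
instance : Category.{u} TensorScheme.{u} where
  Hom := Hom
  id := Hom.id
  comp := Hom.comp
  id_comp {D _} φ := Hom.ext_heq (fun _ => rfl) fun _ _ f =>
    (Hom.comp_mor_heq (Hom.id D) φ f).trans
      (φ.mor_heq (List.map_id' _) (List.map_id' _) (Hom.id_mor_heq f))
  comp_id φ := Hom.ext_heq (fun _ => rfl) fun _ _ f =>
    (Hom.comp_mor_heq φ _ f).trans (Hom.id_mor_heq _)
  assoc φ ψ χ := Hom.ext_heq (fun _ => rfl) fun _ _ f =>
    (Hom.comp_mor_heq _ _ f).trans ((χ.mor_heq (Hom.map_comp_obj φ ψ _) (Hom.map_comp_obj φ ψ _)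
      (Hom.comp_mor_heq _ _ f)).trans
      (HEq.symm ((Hom.comp_mor_heq _ _ f).trans (Hom.comp_mor_heq _ _ _))))

end TensorScheme

/-! ## Strict tensor categories -/

/-- The operations of a (small) strict tensor category, without the axioms. -/
structure TensorData where
  /-- objects -/
  Ob : Type u
  /-- morphisms with a given source and a given target -/
  Hom : Ob → Ob → Type u
  /-- the unit object -/
  unit : Ob
  /-- the tensor product of objects -/
  tensorObj : Ob → Ob → Ob
  /-- identity morphisms -/
  id : ∀ x, Hom x x
  /-- composition, in diagrammatic order -/
  comp : ∀ {x y z}, Hom x y → Hom y z → Hom x z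
  /-- the tensor product of morphisms -/
  tensor : ∀ {x y z w}, Hom x y → Hom z w → Hom (tensorObj x z) (tensorObj y w)

namespace TensorData

/-- The axioms of a strict tensor category: `comp` and `id` form a category, `⊗` is a bifunctor,
and `⊗` is strictly associative and strictly unital on objects and on morphisms. -/
structure IsStrict (V : TensorData.{u}) : Prop where
  id_comp : ∀ {x y} (f : V.Hom x y), V.comp (V.id x) f = f
  comp_id : ∀ {x y} (f : V.Hom x y), V.comp f (V.id y) = f
  comp_assoc : ∀ {x y z w} (f : V.Hom x y) (g : V.Hom y z) (h : V.Hom z w),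
    V.comp (V.comp f g) h = V.comp f (V.comp g h)
  tensor_id : ∀ x y, V.tensor (V.id x) (V.id y) = V.id (V.tensorObj x y)
  tensor_comp : ∀ {x y z x' y' z'} (f : V.Hom x y) (g : V.Hom y z)
    (f' : V.Hom x' y') (g' : V.Hom y' z'),
    V.tensor (V.comp f g) (V.comp f' g') = V.comp (V.tensor f f') (V.tensor g g')
  tensorObj_assoc : ∀ x y z,
    V.tensorObj (V.tensorObj x y) z = V.tensorObj x (V.tensorObj y z)
  unit_tensorObj : ∀ x, V.tensorObj V.unit x = x
  tensorObj_unit : ∀ x, V.tensorObj x V.unit = x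
  tensor_assoc : ∀ {x y x' y' x'' y''} (f : V.Hom x y) (g : V.Hom x' y') (h : V.Hom x'' y''),
    HEq (V.tensor (V.tensor f g) h) (V.tensor f (V.tensor g h))
  unit_tensor : ∀ {x y} (f : V.Hom x y), HEq (V.tensor (V.id V.unit) f) f
  tensor_unit : ∀ {x y} (f : V.Hom x y), HEq (V.tensor f (V.id V.unit)) f

/-- Transport of a morphism along equalities of objects. -/
def castHom (V : TensorData.{u}) {x y x' y' : V.Ob} (h : x = x') (h' : y = y')
    (f : V.Hom x y) : V.Hom x' y' :=
  cast (by rw [h, h']) f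

theorem castHom_heq (V : TensorData.{u}) {x y x' y' : V.Ob} (h : x = x') (h' : y = y')
    (f : V.Hom x y) : HEq (V.castHom h h' f) f :=
  cast_heq _ _

/-- The tensor product `x₁ ⊗ ⋯ ⊗ xₘ` of a word of objects; it is the unit object for the empty
word. -/
def tensorList (V : TensorData.{u}) : List V.Ob → V.Ob :=
  List.foldr V.tensorObj V.unit

end TensorData

/-- A small strict tensor category. -/
structure StrictTensorCat extends TensorData.{u} where
  isStrict : toTensorData.IsStrict

/-- A map on objects together with a map on morphisms, without the axioms of a functor. -/
structure TensorMap (V W : TensorData.{u}) where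
  /-- the map on objects -/
  obj : V.Ob → W.Ob
  /-- the map on morphisms -/
  map : ∀ {x y}, V.Hom x y → W.Hom (obj x) (obj y)

/-- The axioms of a strict tensor functor. -/
structure TensorMap.IsStrictFunctor {V W : TensorData.{u}} (K : TensorMap V W) : Prop where
  map_id : ∀ x, K.map (V.id x) = W.id (K.obj x)
  map_comp : ∀ {x y z} (f : V.Hom x y) (g : V.Hom y z),
    K.map (V.comp f g) = W.comp (K.map f) (K.map g)
  obj_unit : K.obj V.unit = W.unit
  obj_tensor : ∀ x y, K.obj (V.tensorObj x y) = W.tensorObj (K.obj x) (K.obj y)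
  map_tensor : ∀ {x y z w} (f : V.Hom x y) (g : V.Hom z w),
    HEq (K.map (V.tensor f g)) (W.tensor (K.map f) (K.map g))

namespace StrictTensorCat

/-- A strict tensor functor. -/
structure Functor (V W : StrictTensorCat.{u}) extends
    TensorMap V.toTensorData W.toTensorData where
  isStrictFunctor : toTensorMap.IsStrictFunctor

/-- All morphisms of a strict tensor category. -/
def Arr (V : StrictTensorCat.{u}) : Type u := Σ x y : V.Ob, V.Hom x y

/-- A morphism as an element of the set of all morphisms. -/
def arr (V : StrictTensorCat.{u}) {x y : V.Ob} (f : V.Hom x y) : V.Arr := ⟨x, y, f⟩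

theorem arr_congr (V : StrictTensorCat.{u}) {x y x' y' : V.Ob} {f : V.Hom x y} {f' : V.Hom x' y'}
    (h : x = x') (h' : y = y') (hf : HEq f f') : V.arr f = V.arr f' := by
  subst h h'
  rw [eq_of_heq hf]

theorem heq_of_arr (V : StrictTensorCat.{u}) {x y x' y' : V.Ob} {f : V.Hom x y}
    {f' : V.Hom x' y'} (h : V.arr f = V.arr f') : HEq f f' := by
  unfold arr at h
  cases h
  rfl

theorem arr_inj (V : StrictTensorCat.{u}) {x y : V.Ob} {f f' : V.Hom x y}
    (h : V.arr f = V.arr f') : f = f' := eq_of_heq (V.heq_of_arr h)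

theorem arr_castHom (V : StrictTensorCat.{u}) {x y x' y' : V.Ob} (h : x = x') (h' : y = y')
    (f : V.Hom x y) : V.arr (V.castHom h h' f) = V.arr f :=
  V.arr_congr h.symm h'.symm (V.castHom_heq h h' f)

theorem arr_id (V : StrictTensorCat.{u}) {x y : V.Ob} (h : x = y) :
    V.arr (V.id x) = V.arr (V.id y) := by subst h; rfl

instance (V : StrictTensorCat.{u}) : Monoid V.Arr where
  mul a b := ⟨_, _, V.tensor a.2.2 b.2.2⟩
  one := ⟨_, _, V.id V.unit⟩
  mul_assoc a b c := V.arr_congr (V.isStrict.tensorObj_assoc _ _ _)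
    (V.isStrict.tensorObj_assoc _ _ _) (V.isStrict.tensor_assoc a.2.2 b.2.2 c.2.2)
  one_mul a := V.arr_congr (V.isStrict.unit_tensorObj _) (V.isStrict.unit_tensorObj _)
    (V.isStrict.unit_tensor a.2.2)
  mul_one a := V.arr_congr (V.isStrict.tensorObj_unit _) (V.isStrict.tensorObj_unit _)
    (V.isStrict.tensor_unit a.2.2)

theorem arr_tensor (V : StrictTensorCat.{u}) {x y z w : V.Ob} (f : V.Hom x y) (g : V.Hom z w) :
    V.arr (V.tensor f g) = V.arr f * V.arr g := rfl

theorem arr_unit (V : StrictTensorCat.{u}) : V.arr (V.id V.unit) = 1 := rfl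

theorem arr_id_tensor (V : StrictTensorCat.{u}) (x y : V.Ob) :
    V.arr (V.id (V.tensorObj x y)) = V.arr (V.id x) * V.arr (V.id y) := by
  rw [← arr_tensor, V.isStrict.tensor_id]

theorem arr_comp_congr (V : StrictTensorCat.{u}) {x y z x' y' z' : V.Ob}
    {f : V.Hom x y} {g : V.Hom y z} {f' : V.Hom x' y'} {g' : V.Hom y' z'}
    (hf : V.arr f = V.arr f') (hg : V.arr g = V.arr g') :
    V.arr (V.comp f g) = V.arr (V.comp f' g') := by
  unfold arr at hf hg
  cases hf
  cases hg
  rfl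

theorem arr_comp_mul (V : StrictTensorCat.{u}) {x y z x' y' z' : V.Ob}
    (f : V.Hom x y) (g : V.Hom y z) (f' : V.Hom x' y') (g' : V.Hom y' z') :
    V.arr (V.comp f g) * V.arr (V.comp f' g') =
      V.arr (V.comp (V.tensor f f') (V.tensor g g')) := by
  rw [← arr_tensor, V.isStrict.tensor_comp]

theorem tensorList_append (V : StrictTensorCat.{u}) (xs ys : List V.Ob) :
    V.tensorList (xs ++ ys) = V.tensorObj (V.tensorList xs) (V.tensorList ys) := by
  induction xs with
  | nil => exact (V.isStrict.unit_tensorObj _).symm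
  | cons x xs ih =>
    change V.tensorObj x (V.tensorList (xs ++ ys)) = _
    rw [ih, ← V.isStrict.tensorObj_assoc]
    rfl

theorem tensorList_singleton (V : StrictTensorCat.{u}) (x : V.Ob) : V.tensorList [x] = x :=
  V.isStrict.tensorObj_unit x

theorem arr_id_append (V : StrictTensorCat.{u}) (xs ys : List V.Ob) :
    V.arr (V.id (V.tensorList (xs ++ ys))) =
      V.arr (V.id (V.tensorList xs)) * V.arr (V.id (V.tensorList ys)) := by
  rw [V.arr_id (V.tensorList_append xs ys), arr_id_tensor]

namespace Functor

theorem ext_heq {V W : StrictTensorCat.{u}} {K L : Functor V W} (h : ∀ x, K.obj x = L.obj x)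
    (h' : ∀ {x y : V.Ob} (f : V.Hom x y), HEq (K.map f) (L.map f)) : K = L := by
  obtain ⟨⟨o, m⟩, hK⟩ := K
  obtain ⟨⟨o', m'⟩, hL⟩ := L
  obtain rfl : o = o' := funext h
  congr
  funext x y f
  exact eq_of_heq (h' f)

theorem map_heq {V W : StrictTensorCat.{u}} (K : Functor V W) {x y x' y' : V.Ob}
    (h : x = x') (h' : y = y') {f : V.Hom x y} {f' : V.Hom x' y'} (hf : HEq f f') :
    HEq (K.map f) (K.map f') := by
  subst h h'
  rw [eq_of_heq hf]

/-- The identity functor. -/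
def id (V : StrictTensorCat.{u}) : Functor V V where
  obj x := x
  map f := f
  isStrictFunctor := ⟨fun _ => rfl, fun _ _ => rfl, rfl, fun _ _ => rfl, fun _ _ => HEq.rfl⟩

/-- Composition of strict tensor functors. -/
def comp {V W X : StrictTensorCat.{u}} (K : Functor V W) (L : Functor W X) : Functor V X where
  obj x := L.obj (K.obj x)
  map f := L.map (K.map f)
  isStrictFunctor :=
    { map_id := fun x => (congrArg L.map (K.isStrictFunctor.map_id x)).trans (L.isStrictFunctor.map_id _)
      map_comp := fun f g =>
        (congrArg L.map (K.isStrictFunctor.map_comp f g)).trans (L.isStrictFunctor.map_comp _ _)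
      obj_unit := (congrArg L.obj K.isStrictFunctor.obj_unit).trans L.isStrictFunctor.obj_unit
      obj_tensor := fun x y =>
        (congrArg L.obj (K.isStrictFunctor.obj_tensor x y)).trans (L.isStrictFunctor.obj_tensor _ _)
      map_tensor := fun f g =>
        (L.map_heq (K.isStrictFunctor.obj_tensor _ _) (K.isStrictFunctor.obj_tensor _ _)
          (K.isStrictFunctor.map_tensor f g)).trans (L.isStrictFunctor.map_tensor _ _) }

theorem obj_tensorList {V W : StrictTensorCat.{u}} (K : Functor V W) (xs : List V.Ob) :
    K.obj (V.tensorList xs) = W.tensorList (xs.map K.obj) := by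
  induction xs with
  | nil => exact K.isStrictFunctor.obj_unit
  | cons x xs ih =>
    change K.obj (V.tensorObj x (V.tensorList xs)) = _
    rw [K.isStrictFunctor.obj_tensor, ih]
    rfl

/-- The map induced on the sets of all morphisms. -/
def onArr {V W : StrictTensorCat.{u}} (K : Functor V W) : V.Arr →* W.Arr where
  toFun a := ⟨_, _, K.map a.2.2⟩
  map_one' := by
    change W.arr (K.map (V.id V.unit)) = _
    rw [K.isStrictFunctor.map_id, W.arr_id K.isStrictFunctor.obj_unit, arr_unit]
  map_mul' a b := W.arr_congr (K.isStrictFunctor.obj_tensor _ _)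
    (K.isStrictFunctor.obj_tensor _ _) (K.isStrictFunctor.map_tensor _ _)

theorem arr_map {V W : StrictTensorCat.{u}} (K : Functor V W) {x y : V.Ob} (f : V.Hom x y) :
    W.arr (K.map f) = K.onArr (V.arr f) := rfl

theorem onArr_id_tensorList {V W : StrictTensorCat.{u}} (K : Functor V W) (xs : List V.Ob) :
    K.onArr (V.arr (V.id (V.tensorList xs))) = W.arr (W.id (W.tensorList (xs.map K.obj))) := by
  rw [← arr_map, K.isStrictFunctor.map_id, W.arr_id (K.obj_tensorList xs)]

end Functor

/-- The category `Str.T` of small strict tensor categories and strict tensor functors. -/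
instance : Category.{u} StrictTensorCat.{u} where
  Hom := Functor
  id := Functor.id
  comp := Functor.comp

end StrictTensorCat

/-! ## The fission functor `U` -/

/-- The tensor scheme `U(V)` of prime diagrams in `V`.  A prime diagram consists of one vertex with
linearly ordered inputs labelled by `x₁, …, xₘ`, linearly ordered outputs labelled by `y₁, …, yₙ`,
the vertex being labelled by a morphism `x₁ ⊗ ⋯ ⊗ xₘ ⟶ y₁ ⊗ ⋯ ⊗ yₙ` of `V`. -/
abbrev fissionObj (V : StrictTensorCat.{u}) : TensorScheme.{u} where
  Ob := V.Ob
  Mor xs ys := V.Hom (V.tensorList xs) (V.tensorList ys)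

/-- The morphism `U(K)` of tensor schemes: relabel prime diagrams along `K`. -/
def fissionMap {V W : StrictTensorCat.{u}} (K : StrictTensorCat.Functor V W) :
    TensorScheme.Hom (fissionObj V) (fissionObj W) where
  obj := K.obj
  mor f := W.castHom (K.obj_tensorList _) (K.obj_tensorList _) (K.map f)

theorem fissionMap_mor_heq {V W : StrictTensorCat.{u}} (K : StrictTensorCat.Functor V W)
    {xs ys : List V.Ob} (f : V.Hom (V.tensorList xs) (V.tensorList ys)) :
    HEq ((fissionMap K).mor (xs := xs) (ys := ys) f) (K.map f) :=
  cast_heq _ _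

theorem fissionMap_id (V : StrictTensorCat.{u}) :
    fissionMap (StrictTensorCat.Functor.id V) = TensorScheme.Hom.id (fissionObj V) :=
  TensorScheme.Hom.ext_heq (fun _ => rfl) fun _ _ f =>
    (fissionMap_mor_heq _ f).trans (TensorScheme.Hom.id_mor_heq _).symm

theorem fissionMap_comp {V W X : StrictTensorCat.{u}} (K : StrictTensorCat.Functor V W)
    (L : StrictTensorCat.Functor W X) :
    fissionMap (K.comp L) = (fissionMap K).comp (fissionMap L) :=
  TensorScheme.Hom.ext_heq (fun _ => rfl) fun _ _ f =>
    (fissionMap_mor_heq _ f).trans (HEq.trans (HEq.trans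
      (L.map_heq (K.obj_tensorList _) (K.obj_tensorList _) (fissionMap_mor_heq K f).symm)
      (fissionMap_mor_heq L _).symm) (TensorScheme.Hom.comp_mor_heq _ _ _).symm)

/-- The functor `U : Str.T ⥤ T.Sch`. -/
def fission : StrictTensorCat.{u} ⥤ TensorScheme.{u} where
  obj := fissionObj
  map := fissionMap
  map_id V := fissionMap_id V
  map_comp K L := fissionMap_comp K L

/-! ## Diagrams in a tensor scheme -/

/-- A layer of a leveled progressive plane diagram in `D`: one vertex, labelled by the morphism
`gen : src ⟶ tgt` of `D`, with vertical strands labelled by `left` on its left and by `right` on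
its right. -/
structure Layer (D : TensorScheme.{u}) where
  left : List D.Ob
  right : List D.Ob
  src : List D.Ob
  tgt : List D.Ob
  gen : D.Mor src tgt

namespace Layer

variable {D : TensorScheme.{u}}

/-- The word read off above the vertex. -/
def dom (l : Layer D) : List D.Ob := l.left ++ (l.src ++ l.right)

/-- The word read off below the vertex. -/
def cod (l : Layer D) : List D.Ob := l.left ++ (l.tgt ++ l.right)

/-- Add vertical strands on the left. -/
def addLeft (w : List D.Ob) (l : Layer D) : Layer D :=
  ⟨w ++ l.left, l.right, l.src, l.tgt, l.gen⟩

/-- Add vertical strands on the right. -/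
def addRight (w : List D.Ob) (l : Layer D) : Layer D :=
  ⟨l.left, l.right ++ w, l.src, l.tgt, l.gen⟩

/-- Push-forward along a morphism of tensor schemes. -/
def map {E : TensorScheme.{u}} (φ : TensorScheme.Hom D E) (l : Layer D) : Layer E :=
  ⟨l.left.map φ.obj, l.right.map φ.obj, l.src.map φ.obj, l.tgt.map φ.obj, φ.mor l.gen⟩

theorem addRight_nil : addRight (D := D) [] = id := by
  funext l
  simp [addRight]

theorem addRight_comp_addRight (w v : List D.Ob) :
    addRight v ∘ addRight w = addRight (D := D) (w ++ v) := by
  funext l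
  simp [addRight]

theorem addLeft_comp_addLeft (w v : List D.Ob) :
    addLeft v ∘ addLeft w = addLeft (D := D) (v ++ w) := by
  funext l
  simp [addLeft]

theorem addRight_comp_addLeft (w v : List D.Ob) :
    addRight v ∘ addLeft w = addLeft (D := D) w ∘ addRight v := rfl

theorem map_comp_addLeft {E : TensorScheme.{u}} (φ : TensorScheme.Hom D E) (w : List D.Ob) :
    map φ ∘ addLeft w = addLeft (w.map φ.obj) ∘ map φ := by
  funext l
  simp [addLeft, map]

theorem map_comp_addRight {E : TensorScheme.{u}} (φ : TensorScheme.Hom D E) (w : List D.Ob) :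
    map φ ∘ addRight w = addRight (w.map φ.obj) ∘ map φ := by
  funext l
  simp [addRight, map]

end Layer

/-- `IsPath w L v`: the layers in `L`, stacked from top to bottom, form a diagram with domain `w`
and codomain `v`. -/
def IsPath {D : TensorScheme.{u}} : List D.Ob → List (Layer D) → List D.Ob → Prop
  | w, [], v => w = v
  | w, l :: L, v => w = l.dom ∧ IsPath l.cod L v

/-- The elementary deformation of leveled progressive plane diagrams: two consecutive vertices, the
first one lying to the left of the second one and not joined to it, exchange their levels. -/
inductive Interchange {D : TensorScheme.{u}} : List (Layer D) → List (Layer D) → Prop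
  | swap (L R : List (Layer D)) (a b c x y x' y' : List D.Ob) (f : D.Mor x y) (g : D.Mor x' y') :
    Interchange
      (L ++ ([⟨a, b ++ (x' ++ c), x, y, f⟩, ⟨a ++ (y ++ b), c, x', y', g⟩] ++ R))
      (L ++ ([⟨a ++ (x ++ b), c, x', y', g⟩, ⟨a, b ++ (y' ++ c), x, y, f⟩] ++ R))

/-- The equivalence relation generated by elementary deformations. -/
def Deform {D : TensorScheme.{u}} : List (Layer D) → List (Layer D) → Prop :=
  Relation.EqvGen Interchange

/-- A leveled progressive plane diagram in `D` with domain `w` and codomain `v`: finitely many layers,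
each of them with exactly one vertex, stacked from top to bottom. -/
structure Diagram (D : TensorScheme.{u}) (w v : List D.Ob) where
  layers : List (Layer D)
  isPath : IsPath w layers v

/-- Two diagrams are isomorphic if they can be deformed into each other. -/
instance diagramSetoid (D : TensorScheme.{u}) (w v : List D.Ob) : Setoid (Diagram D w v) where
  r d e := Deform d.layers e.layers
  iseqv := ⟨fun _ => Relation.EqvGen.refl _, fun h => Relation.EqvGen.symm _ _ h,
    fun h h' => Relation.EqvGen.trans _ _ _ h h'⟩

section Paths

variable {D : TensorScheme.{u}}

theorem isPath_append {w v : List D.Ob} (L M : List (Layer D)) :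
    IsPath w (L ++ M) v ↔ ∃ z, IsPath w L z ∧ IsPath z M v := by
  induction L generalizing w with
  | nil => simp [IsPath]
  | cons l L ih => simp [IsPath, ih, and_assoc]

theorem IsPath.append {w z v : List D.Ob} {L M : List (Layer D)} (h : IsPath w L z)
    (h' : IsPath z M v) : IsPath w (L ++ M) v := (isPath_append L M).2 ⟨z, h, h'⟩

theorem IsPath.addLeft {w v : List D.Ob} (a : List D.Ob) {L : List (Layer D)}
    (h : IsPath w L v) : IsPath (a ++ w) (L.map (Layer.addLeft a)) (a ++ v) := by
  induction L generalizing w with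
  | nil => exact congrArg _ h
  | cons l L ih =>
    obtain ⟨rfl, h⟩ := h
    refine ⟨by simp [Layer.dom, Layer.addLeft], ?_⟩
    have := ih h
    simpa [Layer.cod, Layer.addLeft] using this

theorem IsPath.addRight {w v : List D.Ob} (a : List D.Ob) {L : List (Layer D)}
    (h : IsPath w L v) : IsPath (w ++ a) (L.map (Layer.addRight a)) (v ++ a) := by
  induction L generalizing w with
  | nil => exact congrArg (· ++ a) h
  | cons l L ih =>
    obtain ⟨rfl, h⟩ := h
    refine ⟨by simp [Layer.dom, Layer.addRight], ?_⟩
    have := ih h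
    simpa [Layer.cod, Layer.addRight] using this

theorem IsPath.map {E : TensorScheme.{u}} (φ : TensorScheme.Hom D E) {w v : List D.Ob} {L : List (Layer D)}
    (h : IsPath w L v) : IsPath (w.map φ.obj) (L.map (Layer.map φ)) (v.map φ.obj) := by
  induction L generalizing w with
  | nil => exact congrArg _ h
  | cons l L ih =>
    obtain ⟨rfl, h⟩ := h
    refine ⟨by simp [Layer.dom, Layer.map], ?_⟩
    have := ih h
    simpa [Layer.cod, Layer.map] using this

theorem Deform.refl (L : List (Layer D)) : Deform L L := Relation.EqvGen.refl _

theorem Deform.of_eq {L M : List (Layer D)} (h : L = M) : Deform L M := h ▸ Deform.refl L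

theorem Deform.symm {L M : List (Layer D)} (h : Deform L M) : Deform M L :=
  Relation.EqvGen.symm _ _ h

theorem Deform.trans {L M N : List (Layer D)} (h : Deform L M) (h' : Deform M N) : Deform L N :=
  Relation.EqvGen.trans _ _ _ h h'

theorem Deform.lift {E : TensorScheme.{u}} (F : List (Layer D) → List (Layer E))
    (hF : ∀ L M, Interchange L M → Interchange (F L) (F M)) {L M : List (Layer D)}
    (h : Deform L M) : Deform (F L) (F M) := by
  induction h with
  | rel _ _ h => exact Relation.EqvGen.rel _ _ (hF _ _ h)
  | refl => exact Relation.EqvGen.refl _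
  | symm _ _ _ ih => exact ih.symm
  | trans _ _ _ _ _ ih ih' => exact ih.trans ih'

theorem Deform.append {L L' M M' : List (Layer D)} (h : Deform L L') (h' : Deform M M') :
    Deform (L ++ M) (L' ++ M') := by
  refine (Deform.lift (· ++ M) ?_ h).trans (Deform.lift (L' ++ ·) ?_ h')
  · rintro _ _ ⟨A, R, a, b, c, x, y, x', y', f, g⟩
    simpa using Interchange.swap A (R ++ M) a b c x y x' y' f g
  · rintro _ _ ⟨A, R, a, b, c, x, y, x', y', f, g⟩
    simpa using Interchange.swap (L' ++ A) R a b c x y x' y' f g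

theorem Deform.addLeft (w : List D.Ob) {L M : List (Layer D)} (h : Deform L M) :
    Deform (L.map (Layer.addLeft w)) (M.map (Layer.addLeft w)) := by
  refine Deform.lift _ ?_ h
  rintro _ _ ⟨A, R, a, b, c, x, y, x', y', f, g⟩
  simpa [Layer.addLeft] using Interchange.swap (A.map (Layer.addLeft w))
    (R.map (Layer.addLeft w)) (w ++ a) b c x y x' y' f g

theorem Deform.addRight (w : List D.Ob) {L M : List (Layer D)} (h : Deform L M) :
    Deform (L.map (Layer.addRight w)) (M.map (Layer.addRight w)) := by
  refine Deform.lift _ ?_ h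
  rintro _ _ ⟨A, R, a, b, c, x, y, x', y', f, g⟩
  simpa [Layer.addRight] using Interchange.swap (A.map (Layer.addRight w))
    (R.map (Layer.addRight w)) a b (c ++ w) x y x' y' f g

theorem Deform.map {E : TensorScheme.{u}} (φ : TensorScheme.Hom D E) {L M : List (Layer D)} (h : Deform L M) :
    Deform (L.map (Layer.map φ)) (M.map (Layer.map φ)) := by
  refine Deform.lift _ ?_ h
  rintro _ _ ⟨A, R, a, b, c, x, y, x', y', f, g⟩
  simpa [Layer.map] using Interchange.swap (A.map (Layer.map φ))
    (R.map (Layer.map φ)) (a.map φ.obj) (b.map φ.obj) (c.map φ.obj) _ _ _ _ (φ.mor f) (φ.mor g)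

theorem deform_layer (l : Layer D) {w v : List D.Ob} {M : List (Layer D)} (h : IsPath w M v) :
    Deform (l.addRight w :: M.map (Layer.addLeft l.cod))
      (M.map (Layer.addLeft l.dom) ++ [l.addRight v]) := by
  induction M generalizing w with
  | nil =>
    obtain rfl := h
    exact Deform.refl _
  | cons m M ih =>
    obtain ⟨rfl, h⟩ := h
    have h1 := Deform.append (Deform.refl [m.addLeft l.dom]) (ih h)
    refine Deform.trans ?_ h1
    apply Relation.EqvGen.rel
    have := Interchange.swap [] (M.map (Layer.addLeft l.cod)) l.left (l.right ++ m.left) m.right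
      l.src l.tgt m.src m.tgt l.gen m.gen
    simpa [Layer.addLeft, Layer.addRight, Layer.cod, Layer.dom] using this

theorem deform_exchange {w v w' v' : List D.Ob} {L M : List (Layer D)} (h : IsPath w L v)
    (h' : IsPath w' M v') :
    Deform (L.map (Layer.addRight w') ++ M.map (Layer.addLeft v))
      (M.map (Layer.addLeft w) ++ L.map (Layer.addRight v')) := by
  induction L generalizing w with
  | nil =>
    obtain rfl := h
    simpa using Deform.refl _
  | cons l L ih =>
    obtain ⟨rfl, h⟩ := h
    have h1 := Deform.append (Deform.refl [l.addRight w']) (ih h)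
    have h2 := Deform.append (deform_layer l h') (Deform.refl (L.map (Layer.addRight v')))
    simp only [List.map_cons, List.cons_append, List.nil_append, List.append_assoc] at h1 h2 ⊢
    exact h1.trans h2

end Paths

/-! ## The aggregation functor `F` -/

/-- The composition of two diagrams: stacking. -/
def Diagram.comp {D : TensorScheme.{u}} {w v z : List D.Ob} (d : Diagram D w v)
    (e : Diagram D v z) : Diagram D w z :=
  ⟨d.layers ++ e.layers, d.isPath.append e.isPath⟩

/-- The tensor product of two diagrams: juxtaposition, with the vertices of the first diagram on
higher levels than those of the second one. -/
def Diagram.tensor {D : TensorScheme.{u}} {w v w' v' : List D.Ob} (d : Diagram D w v)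
    (e : Diagram D w' v') : Diagram D (w ++ w') (v ++ v') :=
  ⟨d.layers.map (Layer.addRight w') ++ e.layers.map (Layer.addLeft v),
    (d.isPath.addRight w').append (e.isPath.addLeft v)⟩

/-- The operations of the strict tensor category `F(D)`: objects are words, morphisms are
isomorphism classes of diagrams, identities are diagrams without vertices. -/
abbrev aggregationData (D : TensorScheme.{u}) : TensorData.{u} where
  Ob := List D.Ob
  Hom w v := Quotient (diagramSetoid D w v)
  unit := []
  tensorObj w v := w ++ v
  id _ := ⟦⟨[], rfl⟩⟧
  comp := Quotient.map₂ Diagram.comp fun _ _ h _ _ h' => Deform.append h h'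
  tensor := Quotient.map₂ Diagram.tensor fun _ _ h _ _ h' =>
    Deform.append (Deform.addRight _ h) (Deform.addLeft _ h')

theorem mk_heq {D : TensorScheme.{u}} {w v w' v' : List D.Ob} (hw : w = w') (hv : v = v')
    {d : Diagram D w v} {d' : Diagram D w' v'} (h : Deform d.layers d'.layers) :
    HEq (Quotient.mk (diagramSetoid D w v) d) (Quotient.mk (diagramSetoid D w' v') d') := by
  subst hw hv
  exact heq_of_eq (Quotient.sound h)

theorem aggregationData_isStrict (D : TensorScheme.{u}) : (aggregationData D).IsStrict where
  id_comp f := by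
    induction f using Quotient.inductionOn with | _ d => ?_
    exact Quotient.sound (Deform.refl _)
  comp_id f := by
    induction f using Quotient.inductionOn with | _ d => ?_
    refine Quotient.sound (?_ : Deform (d.layers ++ []) d.layers)
    rw [List.append_nil]
    exact Deform.refl _
  comp_assoc f g h := by
    induction f, g using Quotient.inductionOn₂ with | _ d e => ?_
    induction h using Quotient.inductionOn with | _ k => ?_
    refine Quotient.sound (?_ : Deform ((d.layers ++ e.layers) ++ k.layers) _)
    rw [List.append_assoc]
    exact Deform.refl _
  tensor_id x y := rfl
  tensor_comp {_ _ z _ _ _} f g f' g' := by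
    induction f, g using Quotient.inductionOn₂ with | _ d e => ?_
    induction f', g' using Quotient.inductionOn₂ with | _ d' e' => ?_
    refine Quotient.sound ?_
    change Deform ((d.layers ++ e.layers).map _ ++ (d'.layers ++ e'.layers).map _)
      ((d.layers.map _ ++ d'.layers.map _) ++ (e.layers.map _ ++ e'.layers.map _))
    simp only [List.map_append, List.append_assoc]
    refine Deform.append (Deform.refl _) ?_
    have := Deform.append (deform_exchange e.isPath d'.isPath)
      (Deform.refl (e'.layers.map (Layer.addLeft z)))
    simpa using this
  tensorObj_assoc := List.append_assoc
  unit_tensorObj _ := rfl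
  tensorObj_unit := List.append_nil
  tensor_assoc f g h := by
    induction f, g using Quotient.inductionOn₂ with | _ d e => ?_
    induction h using Quotient.inductionOn with | _ k => ?_
    refine mk_heq (List.append_assoc _ _ _) (List.append_assoc _ _ _) ?_
    refine Deform.of_eq (?_ : ((d.tensor e).tensor k).layers = (d.tensor (e.tensor k)).layers)
    simp [Diagram.tensor, Layer.addRight_comp_addRight, Layer.addLeft_comp_addLeft,
      Layer.addRight_comp_addLeft]
  unit_tensor f := by
    induction f using Quotient.inductionOn with | _ d => ?_
    exact mk_heq rfl rfl (Deform.of_eq (List.map_id _))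
  tensor_unit f := by
    induction f using Quotient.inductionOn with | _ d => ?_
    refine mk_heq (List.append_nil _) (List.append_nil _)
      (Deform.of_eq (?_ : d.layers.map (Layer.addRight []) ++ [] = d.layers))
    simp [Layer.addRight_nil]

/-- The strict tensor category `F(D)` freely generated by the tensor scheme `D`. -/
abbrev aggregationObj (D : TensorScheme.{u}) : StrictTensorCat.{u} :=
  ⟨aggregationData D, aggregationData_isStrict D⟩

/-- Push-forward of a diagram along a morphism of tensor schemes. -/
def Diagram.map {D E : TensorScheme.{u}} (φ : TensorScheme.Hom D E)
    {w v : List D.Ob} (d : Diagram D w v) : Diagram E (w.map φ.obj) (v.map φ.obj) :=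
  ⟨d.layers.map (Layer.map φ), d.isPath.map φ⟩

/-- The strict tensor functor `F(φ)`. -/
def aggregationMap {D E : TensorScheme.{u}} (φ : TensorScheme.Hom D E) :
    StrictTensorCat.Functor (aggregationObj D) (aggregationObj E) where
  obj w := w.map φ.obj
  map := Quotient.map (Diagram.map φ) fun _ _ h => Deform.map φ h
  isStrictFunctor :=
    { map_id := fun _ => rfl
      map_comp := fun f g => by
        induction f, g using Quotient.inductionOn₂ with | _ d e => ?_
        refine Quotient.sound (?_ : Deform ((d.layers ++ e.layers).map _) _)
        rw [List.map_append]
        exact Deform.refl _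
      obj_unit := rfl
      obj_tensor := fun _ _ => List.map_append
      map_tensor := fun f g => by
        induction f, g using Quotient.inductionOn₂ with | _ d e => ?_
        refine mk_heq List.map_append List.map_append ?_
        refine Deform.of_eq
          (?_ : ((d.tensor e).map φ).layers = ((d.map φ).tensor (e.map φ)).layers)
        simp [Diagram.tensor, Diagram.map, Layer.map_comp_addLeft,
          Layer.map_comp_addRight] }

theorem Layer.mk_eq {D : TensorScheme.{u}} {a b x y a' b' x' y' : List D.Ob} {f : D.Mor x y}
    {f' : D.Mor x' y'} (ha : a = a') (hb : b = b') (hx : x = x') (hy : y = y') (hf : HEq f f') :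
    Layer.mk a b x y f = Layer.mk a' b' x' y' f' := by
  subst ha hb hx hy
  rw [eq_of_heq hf]

theorem Layer.map_id (D : TensorScheme.{u}) : Layer.map (TensorScheme.Hom.id D) = id := by
  funext l
  exact Layer.mk_eq (List.map_id' _) (List.map_id' _) (List.map_id' _) (List.map_id' _)
    (TensorScheme.Hom.id_mor_heq _)

theorem Layer.map_comp {D E G : TensorScheme.{u}} (φ : TensorScheme.Hom D E)
    (ψ : TensorScheme.Hom E G) : Layer.map (φ.comp ψ) = Layer.map ψ ∘ Layer.map φ := by
  funext l
  exact Layer.mk_eq (φ.map_comp_obj ψ _) (φ.map_comp_obj ψ _) (φ.map_comp_obj ψ _)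
    (φ.map_comp_obj ψ _) (TensorScheme.Hom.comp_mor_heq _ _ _)

theorem aggregationMap_id (D : TensorScheme.{u}) :
    aggregationMap (TensorScheme.Hom.id D) = StrictTensorCat.Functor.id (aggregationObj D) := by
  refine StrictTensorCat.Functor.ext_heq (fun _ => List.map_id' _) fun f => ?_
  induction f using Quotient.inductionOn with | _ d => ?_
  refine mk_heq (List.map_id' _) (List.map_id' _) (Deform.of_eq ?_)
  simp [Diagram.map, Layer.map_id]

theorem aggregationMap_comp {D E G : TensorScheme.{u}} (φ : TensorScheme.Hom D E)
    (ψ : TensorScheme.Hom E G) :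
    aggregationMap (φ.comp ψ) = (aggregationMap φ).comp (aggregationMap ψ) := by
  refine StrictTensorCat.Functor.ext_heq (fun w => φ.map_comp_obj ψ w) fun f => ?_
  induction f using Quotient.inductionOn with | _ d => ?_
  refine mk_heq (φ.map_comp_obj ψ _) (φ.map_comp_obj ψ _) (Deform.of_eq ?_)
  simp [Diagram.map, Layer.map_comp]

/-- The functor `F : T.Sch ⥤ Str.T`. -/
def aggregation : TensorScheme.{u} ⥤ StrictTensorCat.{u} where
  obj := aggregationObj
  map := aggregationMap
  map_id D := aggregationMap_id D
  map_comp φ ψ := aggregationMap_comp φ ψ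

/-! ## The unit and the counit -/

/-- The diagram with a single vertex labelled by the morphism `f` of `D`. -/
def generator {D : TensorScheme.{u}} {xs ys : List D.Ob} (f : D.Mor xs ys) :
    (aggregationObj D).Hom xs ys :=
  ⟦⟨[⟨[], [], xs, ys, f⟩], by simp [IsPath, Layer.dom, Layer.cod]⟩⟧

theorem tensorList_aggregation {D : TensorScheme.{u}} (ws : List (List D.Ob)) :
    (aggregationObj D).tensorList ws = ws.flatten := by
  induction ws with
  | nil => rfl
  | cons w ws ih =>
    change w ++ (aggregationObj D).tensorList ws = _
    rw [ih]
    rfl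

theorem tensorList_letters {D : TensorScheme.{u}} (xs : List D.Ob) :
    (aggregationObj D).tensorList (xs.map fun x => [x]) = xs := by
  rw [tensorList_aggregation]
  induction xs with
  | nil => rfl
  | cons x xs ih => exact congrArg (x :: ·) ih

/-- The unit `D ⟶ U(F(D))`: an object goes to the one-letter word, a morphism to the one-vertex
diagram, seen as the label of a prime diagram. -/
def unitMap (D : TensorScheme.{u}) : TensorScheme.Hom D (fissionObj (aggregationObj D)) where
  obj x := [x]
  mor f := (aggregationObj D).castHom (tensorList_letters _).symm (tensorList_letters _).symm
    (generator f)

section Evaluation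

variable (V : StrictTensorCat.{u})

/-- The value `id ⊗ f ⊗ id` of a layer of prime diagrams in `V`. -/
def evalLayer (l : Layer (fissionObj V)) : V.Hom (V.tensorList l.dom) (V.tensorList l.cod) :=
  V.castHom
    ((V.tensorList_append _ _).trans (congrArg _ (V.tensorList_append _ _))).symm
    ((V.tensorList_append _ _).trans (congrArg _ (V.tensorList_append _ _))).symm
    (V.tensor (V.id (V.tensorList l.left)) (V.tensor l.gen (V.id (V.tensorList l.right))))

/-- The value of a stack of layers: the composite of the values of the layers. -/
def evalPath : ∀ {w v : List V.Ob} (L : List (Layer (fissionObj V))), IsPath w L v →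
    V.Hom (V.tensorList w) (V.tensorList v)
  | w, _, [], h => V.castHom rfl (congrArg V.tensorList h) (V.id (V.tensorList w))
  | _, _, l :: L, h => V.castHom (congrArg V.tensorList h.1.symm) rfl
      (V.comp (evalLayer V l) (evalPath L h.2))

/-- The identity of `x₁ ⊗ ⋯ ⊗ xₘ`. -/
def idArr (w : List V.Ob) : V.Arr := V.arr (V.id (V.tensorList w))

theorem idArr_nil : idArr V [] = 1 := rfl

theorem idArr_append (w v : List V.Ob) : idArr V (w ++ v) = idArr V w * idArr V v :=
  V.arr_id_append w v

theorem arr_evalLayer (l : Layer (fissionObj V)) :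
    V.arr (evalLayer V l) = idArr V l.left * (V.arr l.gen * idArr V l.right) :=
  V.arr_castHom _ _ _

theorem arr_evalPath_nil {w v : List V.Ob} (h : IsPath (D := fissionObj V) w [] v) :
    V.arr (evalPath V [] h) = idArr V w := V.arr_castHom _ _ _

theorem arr_evalPath_cons {w v : List V.Ob} (l : Layer (fissionObj V))
    (L : List (Layer (fissionObj V))) (h : IsPath w (l :: L) v) :
    V.arr (evalPath V (l :: L) h) = V.arr (V.comp (evalLayer V l) (evalPath V L h.2)) :=
  V.arr_castHom _ _ _

theorem arr_evalPath_congr {w v w' v' : List V.Ob} {L L' : List (Layer (fissionObj V))}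
    (h : IsPath w L v) (h' : IsPath w' L' v') (hw : w = w') (hv : v = v') (hL : L = L') :
    V.arr (evalPath V L h) = V.arr (evalPath V L' h') := by
  subst hw hv hL
  rfl

theorem arr_id_comp {x y z : V.Ob} {f : V.Hom x y} (g : V.Hom y z) {x' : V.Ob}
    (hf : V.arr f = V.arr (V.id x')) : V.arr (V.comp f g) = V.arr g := by
  unfold StrictTensorCat.arr at hf
  cases hf
  exact congrArg _ (V.isStrict.id_comp g)

theorem arr_comp_id {x y z : V.Ob} (f : V.Hom x y) {g : V.Hom y z} {x' : V.Ob}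
    (hg : V.arr g = V.arr (V.id x')) : V.arr (V.comp f g) = V.arr f := by
  unfold StrictTensorCat.arr at hg
  cases hg
  exact congrArg _ (V.isStrict.comp_id f)

theorem arr_evalPath_append {w z v : List V.Ob} {L M : List (Layer (fissionObj V))}
    (h : IsPath w L z) (h' : IsPath z M v) (h'' : IsPath w (L ++ M) v) :
    V.arr (evalPath V (L ++ M) h'') = V.arr (V.comp (evalPath V L h) (evalPath V M h')) := by
  induction L generalizing w with
  | nil =>
    obtain rfl := h
    exact (arr_id_comp V _ (arr_evalPath_nil V _)).symm
  | cons l L ih =>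
    have h3 : IsPath l.cod (L ++ M) v := h''.2
    refine (arr_evalPath_cons V l (L ++ M) h'').trans ?_
    refine (V.arr_comp_congr rfl (ih h.2 h3)).trans ?_
    refine Eq.trans ?_ (V.arr_comp_congr (arr_evalPath_cons V l L h) rfl).symm
    rw [V.isStrict.comp_assoc]

theorem evalPath_interchange {w v : List V.Ob} {L M : List (Layer (fissionObj V))}
    (h : Interchange L M) : ∀ (h₁ : IsPath w L v) (h₂ : IsPath w M v),
    evalPath V L h₁ = evalPath V M h₂ := by
  obtain ⟨A, R, a, b, c, x, y, x', y', f, g⟩ := h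
  intro h₁ h₂
  obtain ⟨p, hA, hp⟩ := (isPath_append _ _).1 h₁
  obtain ⟨q, hP, hR⟩ := (isPath_append _ _).1 hp
  obtain ⟨p', hA', hp'⟩ := (isPath_append _ _).1 h₂
  obtain ⟨q', hP', hR'⟩ := (isPath_append _ _).1 hp'
  have e1 : p = a ++ (x ++ (b ++ (x' ++ c))) := hP.1
  have e1' : p' = a ++ (x ++ b) ++ (x' ++ c) := hP'.1
  have e2 : a ++ (y ++ b) ++ (y' ++ c) = q := hP.2.2
  have e2' : a ++ (y ++ (b ++ (y' ++ c))) = q' := hP'.2.2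
  obtain rfl : p = p' := by rw [e1, e1']; simp
  obtain rfl : q = q' := by rw [← e2, ← e2']; simp
  apply V.arr_inj
  refine (arr_evalPath_append V hA hp h₁).trans
    (Eq.trans ?_ (arr_evalPath_append V hA hp' h₂).symm)
  refine V.arr_comp_congr rfl ?_
  refine (arr_evalPath_append V hP hR hp).trans
    (Eq.trans ?_ (arr_evalPath_append V hP' hR hp').symm)
  refine V.arr_comp_congr ?_ rfl
  refine (arr_evalPath_cons V _ _ hP).trans (Eq.trans ?_ (arr_evalPath_cons V _ _ hP').symm)
  let A := V.id (V.tensorList a)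
  let B := V.id (V.tensorList b)
  let C := V.id (V.tensorList c)
  let X := V.id (V.tensorList x)
  let Y := V.id (V.tensorList y)
  let X' := V.id (V.tensorList x')
  let Y' := V.id (V.tensorList y')
  let f₀ : V.Hom (V.tensorList x) (V.tensorList y) := f
  let g₀ : V.Hom (V.tensorList x') (V.tensorList y') := g
  have k1 : V.arr (V.comp (V.tensor A (V.tensor f₀ (V.tensor B (V.tensor X' C))))
        (V.tensor A (V.tensor Y (V.tensor B (V.tensor g₀ C))))) =
      V.arr (V.comp (V.tensor A (V.tensor X (V.tensor B (V.tensor g₀ C))))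
        (V.tensor A (V.tensor f₀ (V.tensor B (V.tensor Y' C))))) := by
    simp only [← V.isStrict.tensor_comp, A, B, C, X, Y, X', Y', V.isStrict.id_comp,
      V.isStrict.comp_id]
  refine Eq.trans (V.arr_comp_congr ?_ ?_) (k1.trans (V.arr_comp_congr ?_ ?_).symm)
  · simp only [arr_evalLayer, idArr_append]
    rfl
  · refine ((arr_evalPath_cons V _ _ _).trans (arr_comp_id V _ (arr_evalPath_nil V _))).trans ?_
    simp only [arr_evalLayer, idArr_append, mul_assoc]
    rfl
  · simp only [arr_evalLayer, idArr_append, mul_assoc]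
    rfl
  · refine ((arr_evalPath_cons V _ _ _).trans (arr_comp_id V _ (arr_evalPath_nil V _))).trans ?_
    simp only [arr_evalLayer, idArr_append]
    rfl

theorem isPath_interchange {D : TensorScheme.{u}} {w v : List D.Ob} {L M : List (Layer D)}
    (h : Interchange L M) : IsPath w L v ↔ IsPath w M v := by
  obtain ⟨A, R, a, b, c, x, y, x', y', f, g⟩ := h
  simp [isPath_append, IsPath, Layer.dom, Layer.cod]

theorem isPath_deform {D : TensorScheme.{u}} {w v : List D.Ob} {L M : List (Layer D)}
    (h : Deform L M) : IsPath w L v ↔ IsPath w M v := by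
  induction h with
  | rel _ _ h => exact isPath_interchange h
  | refl => rfl
  | symm _ _ _ ih => exact ih.symm
  | trans _ _ _ _ _ ih ih' => exact ih.trans ih'

theorem evalPath_deform {w v : List V.Ob} {L M : List (Layer (fissionObj V))}
    (h : Deform L M) : ∀ (h₁ : IsPath w L v) (h₂ : IsPath w M v),
    evalPath V L h₁ = evalPath V M h₂ := by
  induction h with
  | rel _ _ h => exact evalPath_interchange V h
  | refl => exact fun _ _ => rfl
  | symm _ _ _ ih => exact fun h₁ h₂ => (ih h₂ h₁).symm
  | trans _ _ _ h _ ih ih' =>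
    exact fun h₁ h₂ => (ih h₁ ((isPath_deform h).1 h₁)).trans (ih' _ h₂)

theorem arr_evalPath_addLeft {w v : List V.Ob} {L : List (Layer (fissionObj V))}
    (a : List V.Ob) (h : IsPath w L v) (h' : IsPath (a ++ w) (L.map (Layer.addLeft a)) (a ++ v)) :
    V.arr (evalPath V _ h') = idArr V a * V.arr (evalPath V L h) := by
  induction L generalizing w with
  | nil =>
    refine (arr_evalPath_nil V h').trans ?_
    rw [idArr_append, arr_evalPath_nil]
  | cons l L ih =>
    have h3 : IsPath (a ++ l.cod) (L.map (Layer.addLeft a)) (a ++ v) := IsPath.addLeft a h.2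
    refine (arr_evalPath_cons V _ _ h').trans ?_
    have h4 : (l.addLeft a).cod = a ++ l.cod := by simp [Layer.addLeft, Layer.cod]
    have h5 := (arr_evalPath_congr V h'.2 h3 h4 rfl rfl).trans (ih h.2 h3)
    rw [arr_evalPath_cons]
    have h6 : V.arr (evalLayer V (l.addLeft a)) = idArr V a * V.arr (evalLayer V l) := by
      rw [arr_evalLayer, arr_evalLayer]
      change idArr V (a ++ l.left) * _ = _
      rw [idArr_append, mul_assoc]
      rfl
    have h7 := V.arr_comp_mul (V.id (V.tensorList a)) (V.id (V.tensorList a)) (evalLayer V l)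
      (evalPath V L h.2)
    rw [V.isStrict.id_comp] at h7
    exact (V.arr_comp_congr h6 h5).trans h7.symm

theorem arr_evalPath_addRight {w v : List V.Ob} {L : List (Layer (fissionObj V))}
    (a : List V.Ob) (h : IsPath w L v)
    (h' : IsPath (w ++ a) (L.map (Layer.addRight a)) (v ++ a)) :
    V.arr (evalPath V _ h') = V.arr (evalPath V L h) * idArr V a := by
  induction L generalizing w with
  | nil =>
    refine (arr_evalPath_nil V h').trans ?_
    rw [idArr_append, arr_evalPath_nil]
  | cons l L ih =>
    have h3 : IsPath (l.cod ++ a) (L.map (Layer.addRight a)) (v ++ a) := IsPath.addRight a h.2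
    refine (arr_evalPath_cons V _ _ h').trans ?_
    have h4 : (l.addRight a).cod = l.cod ++ a := by simp [Layer.addRight, Layer.cod]
    have h5 := (arr_evalPath_congr V h'.2 h3 h4 rfl rfl).trans (ih h.2 h3)
    rw [arr_evalPath_cons]
    have h6 : V.arr (evalLayer V (l.addRight a)) = V.arr (evalLayer V l) * idArr V a := by
      rw [arr_evalLayer, arr_evalLayer]
      change _ * (_ * idArr V (l.right ++ a)) = _
      rw [idArr_append, mul_assoc, mul_assoc]
      rfl
    have h7 := V.arr_comp_mul (evalLayer V l) (evalPath V L h.2) (V.id (V.tensorList a))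
      (V.id (V.tensorList a))
    rw [V.isStrict.id_comp] at h7
    exact (V.arr_comp_congr h6 h5).trans h7.symm

/-- The counit `F(U(V)) ⟶ V`: a word goes to its tensor product, a diagram of prime diagrams in `V`
goes to its value. -/
def counitMap : StrictTensorCat.Functor (aggregationObj (fissionObj V)) V where
  obj w := V.tensorList w
  map f := Quotient.lift (fun d => evalPath V d.layers d.isPath)
    (fun d e h => evalPath_deform V h d.isPath e.isPath) f
  isStrictFunctor :=
    { map_id := fun _ => rfl
      map_comp := fun f g => by
        induction f, g using Quotient.inductionOn₂ with | _ d e => ?_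
        exact V.arr_inj (arr_evalPath_append V d.isPath e.isPath (d.comp e).isPath)
      obj_unit := rfl
      obj_tensor := V.tensorList_append
      map_tensor := fun {x y z w} f g => by
        induction f, g using Quotient.inductionOn₂ with | _ d e => ?_
        refine V.heq_of_arr ?_
        refine (arr_evalPath_append V (d.isPath.addRight z) (e.isPath.addLeft y)
          (d.tensor e).isPath).trans ?_
        have h1 := arr_evalPath_addRight V _ d.isPath (d.isPath.addRight z)
        have h2 := arr_evalPath_addLeft V _ e.isPath (e.isPath.addLeft y)
        refine (V.arr_comp_congr h1 h2).trans ?_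
        have h3 := V.arr_comp_mul (evalPath V d.layers d.isPath) (V.id (V.tensorList y))
          (V.id (V.tensorList z)) (evalPath V e.layers e.isPath)
        rw [V.isStrict.comp_id, V.isStrict.id_comp] at h3
        exact h3.symm }

end Evaluation

/-! ## The adjunction `F ⊣ U` and tensor manifolds -/

theorem arr_generator {D : TensorScheme.{u}} {xs ys xs' ys' : List D.Ob} (h : xs = xs')
    (h' : ys = ys') {f : D.Mor xs ys} {f' : D.Mor xs' ys'} (hf : HEq f f') :
    (aggregationObj D).arr (generator f) = (aggregationObj D).arr (generator f') := by
  subst h h'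
  rw [eq_of_heq hf]

theorem arr_unitMap {D : TensorScheme.{u}} {xs ys : List D.Ob} (f : D.Mor xs ys) :
    (aggregationObj D).arr
        (x := (aggregationObj D).tensorList (xs.map (unitMap D).obj))
        (y := (aggregationObj D).tensorList (ys.map (unitMap D).obj)) ((unitMap D).mor f) =
      (aggregationObj D).arr (generator f) :=
  (aggregationObj D).arr_castHom (tensorList_letters xs).symm (tensorList_letters ys).symm _

theorem unitMap_naturality {D E : TensorScheme.{u}} (φ : TensorScheme.Hom D E) :
    φ.comp (unitMap E) = (unitMap D).comp (fissionMap (aggregationMap φ)) := by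
  refine TensorScheme.Hom.ext_heq (fun _ => rfl) fun xs ys f => ?_
  refine (TensorScheme.Hom.comp_mor_heq _ _ _).trans
    (HEq.trans ?_ (TensorScheme.Hom.comp_mor_heq _ _ _).symm)
  refine HEq.trans ?_ (fissionMap_mor_heq _ _).symm
  refine StrictTensorCat.heq_of_arr (aggregationObj E) ?_
  refine (arr_unitMap _).trans ?_
  exact congrArg (aggregationMap φ).onArr (arr_unitMap f).symm

theorem arr_evalPath_map {V W : StrictTensorCat.{u}} (K : StrictTensorCat.Functor V W)
    {w v : List V.Ob} {L : List (Layer (fissionObj V))} (h : IsPath w L v)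
    (h' : IsPath (w.map K.obj) (L.map (Layer.map (fissionMap K))) (v.map K.obj)) :
    W.arr (evalPath W _ h') = K.onArr (V.arr (evalPath V L h)) := by
  induction L generalizing w with
  | nil =>
    refine (arr_evalPath_nil W h').trans ?_
    rw [arr_evalPath_nil]
    exact (K.onArr_id_tensorList w).symm
  | cons l L ih =>
    have h3 : IsPath (l.cod.map K.obj) (L.map (Layer.map (fissionMap K))) (v.map K.obj) :=
      IsPath.map (fissionMap K) h.2
    refine (arr_evalPath_cons W _ _ h').trans ?_
    have h4 : (l.map (fissionMap K)).cod = l.cod.map K.obj := by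
      simp [Layer.map, Layer.cod, fissionMap]
    have h5 := (arr_evalPath_congr W h'.2 h3 h4 rfl rfl).trans (ih h.2 h3)
    rw [arr_evalPath_cons]
    have h6 : W.arr (evalLayer W (l.map (fissionMap K))) = K.onArr (V.arr (evalLayer V l)) := by
      rw [arr_evalLayer, arr_evalLayer, map_mul, map_mul]
      have h8 : W.arr (x := W.tensorList (l.src.map K.obj)) (y := W.tensorList (l.tgt.map K.obj))
          ((fissionMap K).mor l.gen) =
            K.onArr (V.arr (x := V.tensorList l.src) (y := V.tensorList l.tgt) l.gen) :=
        W.arr_castHom (K.obj_tensorList l.src) (K.obj_tensorList l.tgt) _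
      exact congrArg₂ (· * ·) (K.onArr_id_tensorList l.left).symm
        (congrArg₂ (· * ·) h8 (K.onArr_id_tensorList l.right).symm)
    refine (W.arr_comp_congr (f' := K.map (evalLayer V l)) (g' := K.map (evalPath V L h.2))
      h6 h5).trans ?_
    rw [← K.isStrictFunctor.map_comp]
    rfl

theorem counitMap_naturality {V W : StrictTensorCat.{u}} (K : StrictTensorCat.Functor V W) :
    (aggregationMap (fissionMap K)).comp (counitMap W) = (counitMap V).comp K := by
  refine StrictTensorCat.Functor.ext_heq (fun w => (K.obj_tensorList w).symm) fun {x y} f => ?_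
  induction f using Quotient.inductionOn with | _ d => ?_
  exact W.heq_of_arr (arr_evalPath_map K d.isPath (d.isPath.map (fissionMap K)))

theorem arr_evalPath_unit {D : TensorScheme.{u}} {w v : List D.Ob} {L : List (Layer D)}
    (h : IsPath w L v)
    (h' : IsPath (w.map (unitMap D).obj) (L.map (Layer.map (unitMap D)))
      (v.map (unitMap D).obj)) :
    (aggregationObj D).arr (evalPath (aggregationObj D) _ h') =
      (aggregationObj D).arr (x := w) (y := v) ⟦⟨L, h⟩⟧ := by
  induction L generalizing w with
  | nil =>
    obtain rfl := h
    refine (arr_evalPath_nil _ h').trans ?_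
    exact (aggregationObj D).arr_id (tensorList_letters w)
  | cons l L ih =>
    obtain ⟨rfl, h⟩ := h
    have h3 : IsPath (l.cod.map (unitMap D).obj) (L.map (Layer.map (unitMap D)))
      (v.map (unitMap D).obj) := IsPath.map (unitMap D) h
    refine (arr_evalPath_cons _ _ _ h').trans ?_
    have h4 : (l.map (unitMap D)).cod = l.cod.map (unitMap D).obj := by
      simp [Layer.map, Layer.cod]
    have h5 := (arr_evalPath_congr _ h'.2 h3 h4 rfl rfl).trans (ih h h3)
    have h6 : (aggregationObj D).arr (evalLayer (aggregationObj D) (l.map (unitMap D))) =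
        (aggregationObj D).arr (x := l.dom) (y := l.cod) ⟦⟨[l], rfl, rfl⟩⟧ := by
      refine (arr_evalLayer _ _).trans ?_
      refine (congrArg₂ (· * ·) ((aggregationObj D).arr_id (tensorList_letters l.left))
        (congrArg₂ (· * ·) (arr_unitMap l.gen)
          ((aggregationObj D).arr_id (tensorList_letters l.right)))).trans ?_
      refine (aggregationObj D).arr_congr rfl rfl (mk_heq rfl rfl (Deform.of_eq ?_))
      simp only [Diagram.tensor, List.map_nil, List.map_cons, List.nil_append, List.append_nil]
      exact congrArg (fun a => [Layer.mk a l.right l.src l.tgt l.gen]) (List.append_nil l.left)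
    exact (aggregationObj D).arr_comp_congr h6 h5

theorem left_triangle (D : TensorScheme.{u}) :
    (aggregationMap (unitMap D)).comp (counitMap (aggregationObj D)) =
      StrictTensorCat.Functor.id (aggregationObj D) := by
  refine StrictTensorCat.Functor.ext_heq (fun w => tensorList_letters w) fun {x y} f => ?_
  induction f using Quotient.inductionOn with | _ d => ?_
  exact (aggregationObj D).heq_of_arr (arr_evalPath_unit d.isPath (d.isPath.map (unitMap D)))

theorem right_triangle (V : StrictTensorCat.{u}) :
    (unitMap (fissionObj V)).comp (fissionMap (counitMap V)) =
      TensorScheme.Hom.id (fissionObj V) := by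
  refine TensorScheme.Hom.ext_heq (fun x => V.tensorList_singleton x) fun xs ys f => ?_
  refine (TensorScheme.Hom.comp_mor_heq _ _ _).trans
    (HEq.trans ?_ (TensorScheme.Hom.id_mor_heq _).symm)
  refine (fissionMap_mor_heq _ _).trans ?_
  refine V.heq_of_arr (f' := (f : V.Hom (V.tensorList xs) (V.tensorList ys))) ?_
  refine (congrArg (counitMap V).onArr (arr_unitMap f)).trans ?_
  let l : Layer (fissionObj V) := ⟨[], [], xs, ys, f⟩
  have hl : IsPath xs [l] ys := by simp [IsPath, Layer.dom, Layer.cod, l]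
  refine (arr_evalPath_cons V l [] hl).trans ?_
  refine (arr_comp_id V _ (arr_evalPath_nil V hl.2)).trans ?_
  refine (arr_evalLayer V l).trans ?_
  exact (one_mul _).trans (mul_one _)

/-- The adjunction `F ⊣ U` between `T.Sch` and `Str.T`. -/
def tensorCalculus : aggregation.{u} ⊣ fission.{u} where
  unit :=
    { app := fun D => unitMap D
      naturality := fun _ _ φ => unitMap_naturality φ }
  counit :=
    { app := fun V => counitMap V
      naturality := fun _ _ K => counitMap_naturality K }
  left_triangle_components D := left_triangle D
  right_triangle_components V := right_triangle V

/-- The category `T.Sch^T` of tensor manifolds: the Eilenberg–Moore category of the monad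
`T = U ∘ F` on `T.Sch`. -/
abbrev TensorManifold : Type (u + 1) := (tensorCalculus.{u}).toMonad.Algebra

/-- The comparison functor `Φ : Str.T ⥤ T.Sch^T`. -/
abbrev comparison : StrictTensorCat.{u} ⥤ TensorManifold.{u} := Monad.comparison tensorCalculus.{u}

/-! ## The functor `Ψ` -/

namespace TensorManifold

/-- The structure map `ε : U(F(D)) ⟶ D` of a tensor manifold `(D, ε)`. -/
def str (A : TensorManifold.{u}) : TensorScheme.Hom (fissionObj (aggregationObj A.A)) A.A := A.a

/-- The structure map on objects, sending words to objects. -/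
def fuse (A : TensorManifold.{u}) (w : List A.A.Ob) : A.A.Ob := A.str.obj w

theorem fuse_singleton (A : TensorManifold.{u}) (x : A.A.Ob) : A.fuse [x] = x :=
  congrArg (fun φ : TensorScheme.Hom A.A A.A => φ.obj x) A.unit

/-- The value under the structure map of the prime diagram with one input `w` and one output `v`
labelled by `d : w ⟶ v`. -/
def act (A : TensorManifold.{u}) {w v : List A.A.Ob} (d : (aggregationObj A.A).Hom w v) :
    A.A.Mor [A.fuse w] [A.fuse v] :=
  A.str.mor (xs := [w]) (ys := [v])
    ((aggregationObj A.A).castHom ((aggregationObj A.A).tensorList_singleton w).symm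
      ((aggregationObj A.A).tensorList_singleton v).symm d)

/-- Transport along `ε(x) = x` for one-letter words `x`. -/
def strip (A : TensorManifold.{u}) {x y : A.A.Ob} (f : A.A.Mor [A.fuse [x]] [A.fuse [y]]) :
    A.A.Mor [x] [y] :=
  A.A.castMor (congrArg (fun z => [z]) (A.fuse_singleton x))
    (congrArg (fun z => [z]) (A.fuse_singleton y)) f

end TensorManifold

/-- The objects, morphisms and operations of `Ψ(D, ε)`. The objects are those of `D`, the morphisms
`x ⟶ y` are the morphisms of `D` from the one-letter word `x` to the one-letter word `y`; the unit
object is the value of `ε` at the empty word, `x ⊗ y` is the value of `ε` at the word `xy`; the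
identity of `x`, the composite of `f` and `g`, and `f ⊗ g` are the values of `ε` at the strand
labelled by `x`, at the diagram with `f` above `g`, and at the diagram with `f` to the left of `g`
(with the domain as its single input and the codomain as its single output). -/
def psiData (A : TensorManifold.{u}) : TensorData.{u} where
  Ob := A.A.Ob
  Hom x y := A.A.Mor [x] [y]
  unit := A.fuse []
  tensorObj x y := A.fuse [x, y]
  id x := A.strip (A.act ((aggregationObj A.A).id [x]))
  comp f g := A.strip (A.act ((aggregationObj A.A).comp (generator f) (generator g)))
  tensor f g := A.act ((aggregationObj A.A).tensor (generator f) (generator g))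

/-- The map `Ψ(φ)`: the restriction of the morphism `φ` of tensor manifolds to the morphisms between
one-letter words. -/
def psiMap {A B : TensorManifold.{u}} (φ : A ⟶ B) : TensorMap (psiData A) (psiData B) where
  obj := TensorScheme.Hom.obj φ.f
  map f := TensorScheme.Hom.mor φ.f f

/-- The functor `Ψ : T.Sch^T ⥤ Str.T`, once it is known that its values are strict tensor categories
and strict tensor functors. -/
def psi (h₁ : ∀ A : TensorManifold.{u}, (psiData A).IsStrict)
    (h₂ : ∀ {A B : TensorManifold.{u}} (φ : A ⟶ B), (psiMap φ).IsStrictFunctor) :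
    TensorManifold.{u} ⥤ StrictTensorCat.{u} where
  obj A := ⟨psiData A, h₁ A⟩
  map φ := StrictTensorCat.Functor.mk (psiMap φ) (h₂ φ)
  map_id _ := StrictTensorCat.Functor.ext_heq (fun _ => rfl) fun f =>
    TensorScheme.Hom.id_mor_heq f
  map_comp φ χ := StrictTensorCat.Functor.ext_heq (fun _ => rfl) fun f =>
    TensorScheme.Hom.comp_mor_heq (TensorScheme.Hom.mk φ.f.obj φ.f.mor) χ.f f

end TensorCalculus

namespace TensorCalculus

/-! A tensor manifold `(D, ε)` is a retract of its own free algebra, and `Ψ(D, ε)` inherits its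
axioms from the free strict tensor category `F(D)`. The map `act` reads a diagram `w ⟶ v` over `D`
as a morphism from `ε(w)` to `ε(v)`. By the unit law of the algebra, every morphism `f` of `Ψ(D, ε)`
is `act` of its one-vertex diagram (`arr_act_generator`). By the associativity law, `act` carries
the identities, composition and tensor product of `F(D)` to those of `Ψ(D, ε)` (`arr_id_fuse`,
`arr_comp_act`, `arr_tensor_act`): a diagram whose vertices are themselves labelled by diagrams
gives the same value whether the labels are evaluated first or substituted first. Composable
morphisms have composable one-vertex diagrams, since these meet at the same one-letter word. Hence
each axiom is an equation between values of `act` on two diagrams that agree in `F(D)`. A morphism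
of algebras commutes with `act`, and so restricts to a strict tensor functor.

For `Φ(V)`, `act` is evaluation of diagrams in `V`. So `ΨΦ(V)` differs from `V` only in that its
morphisms `x ⟶ y` are morphisms between the one-letter products `x ⊗ I` and `y ⊗ I`. By strictness
these are `x` and `y`, so `ΨΦ(V)` is equal to `V`, not merely isomorphic to it. This gives `Ψ ∘ Φ ≅
Id`, injectivity of `Φ` on objects, and faithfulness.

For fullness, a morphism `φ : Φ(V) ⟶ Φ(W)` yields a functor `K : V ⟶ W` by transporting `Ψ(φ)`. It
remains to see that `φ` is determined by its restriction to one-letter words: compatibility with the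
structure maps forces `φ` to treat a morphism `xs ⟶ ys` as the same morphism between the one-letter
words `⊗xs` and `⊗ys`. -/

theorem TensorScheme.Hom.mor_heq_of_eq {D E : TensorScheme.{u}} {φ ψ : TensorScheme.Hom D E}
    (h : φ = ψ) {xs ys : List D.Ob} (f : D.Mor xs ys) : HEq (φ.mor f) (ψ.mor f) := by
  subst h
  rfl

/-! ### Morphisms bundled with their endpoints, before any axiom is known. -/

namespace TensorData

/-- All morphisms of a tensor category. -/
def Arr (V : TensorData.{u}) : Type u := Σ x y : V.Ob, V.Hom x y

/-- A morphism as an element of the set of all morphisms. -/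
def arr (V : TensorData.{u}) {x y : V.Ob} (f : V.Hom x y) : V.Arr := ⟨x, y, f⟩

/-- Objects such as `ε([x])` and `x` are equal only propositionally, so equations in `Ψ(D, ε)` are
best compared as equations between bundled arrows. The earlier `StrictTensorCat.arr` does not apply,
because it presupposes the axioms to be proved for `psiData`. -/
theorem arr_congr (V : TensorData.{u}) {x y x' y' : V.Ob} {f : V.Hom x y} {f' : V.Hom x' y'}
    (h : x = x') (h' : y = y') (hf : HEq f f') : V.arr f = V.arr f' := by
  subst h h'
  rw [eq_of_heq hf]

theorem heq_of_arr (V : TensorData.{u}) {x y x' y' : V.Ob} {f : V.Hom x y} {f' : V.Hom x' y'}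
    (h : V.arr f = V.arr f') : HEq f f' := by
  unfold arr at h
  cases h
  rfl

theorem arr_inj (V : TensorData.{u}) {x y : V.Ob} {f f' : V.Hom x y}
    (h : V.arr f = V.arr f') : f = f' := eq_of_heq (V.heq_of_arr h)

theorem arr_comp_congr (V : TensorData.{u}) {x y z x' y' z' : V.Ob}
    {f : V.Hom x y} {g : V.Hom y z} {f' : V.Hom x' y'} {g' : V.Hom y' z'}
    (hf : V.arr f = V.arr f') (hg : V.arr g = V.arr g') :
    V.arr (V.comp f g) = V.arr (V.comp f' g') := by
  unfold arr at hf hg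
  cases hf
  cases hg
  rfl

theorem arr_tensor_congr (V : TensorData.{u}) {x y z w x' y' z' w' : V.Ob}
    {f : V.Hom x y} {g : V.Hom z w} {f' : V.Hom x' y'} {g' : V.Hom z' w'}
    (hf : V.arr f = V.arr f') (hg : V.arr g = V.arr g') :
    V.arr (V.tensor f g) = V.arr (V.tensor f' g') := by
  unfold arr at hf hg
  cases hf
  cases hg
  rfl

end TensorData

/-! ### Prime diagrams and their values under the counit. -/

theorem counitMap_generator (V : StrictTensorCat.{u}) {xs ys : List V.Ob}
    (f : (fissionObj V).Mor xs ys) :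
    V.arr ((counitMap V).map (generator f)) =
      V.arr (x := V.tensorList xs) (y := V.tensorList ys) f := by
  let l : Layer (fissionObj V) := ⟨[], [], xs, ys, f⟩
  have hl : IsPath xs [l] ys := by simp [IsPath, Layer.dom, Layer.cod, l]
  refine (arr_evalPath_cons V l [] hl).trans ?_
  refine (arr_comp_id V _ (arr_evalPath_nil V hl.2)).trans ?_
  refine (arr_evalLayer V l).trans ?_
  -- The words on both sides of the only vertex are empty, and the identity of the unit object is
  -- the neutral element of the monoid of arrows.
  exact (one_mul _).trans (mul_one _)

/-- A diagram seen as the label of a prime diagram with one input and one output. -/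
def prime {D : TensorScheme.{u}} {w v : List D.Ob} (d : (aggregationObj D).Hom w v) :
    (fissionObj (aggregationObj D)).Mor [w] [v] :=
  (aggregationObj D).castHom ((aggregationObj D).tensorList_singleton w).symm
    ((aggregationObj D).tensorList_singleton v).symm d

theorem arr_prime {D : TensorScheme.{u}} {w v : List D.Ob} (d : (aggregationObj D).Hom w v) :
    (aggregationObj D).arr (x := (aggregationObj D).tensorList [w])
      (y := (aggregationObj D).tensorList [v]) (prime d) = (aggregationObj D).arr d :=
  (aggregationObj D).arr_castHom _ _ d

theorem fissionMap_prime {D E : TensorScheme.{u}}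
    (K : StrictTensorCat.Functor (aggregationObj D) (aggregationObj E)) {w v : List D.Ob}
    (d : (aggregationObj D).Hom w v) : (fissionMap K).mor (prime d) = prime (K.map d) := by
  refine eq_of_heq ((fissionMap_mor_heq K _).trans ?_)
  refine HEq.trans ?_ ((aggregationObj E).castHom_heq _ _ _).symm
  exact K.map_heq ((aggregationObj D).tensorList_singleton w)
    ((aggregationObj D).tensorList_singleton v) ((aggregationObj D).castHom_heq _ _ d)

theorem arr_counitMap_prime {D : TensorScheme.{u}} {w v : List D.Ob}
    (d : (aggregationObj D).Hom w v) :
    (aggregationObj D).arr ((counitMap (aggregationObj D)).map (generator (prime d))) =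
      (aggregationObj D).arr d :=
  (counitMap_generator _ _).trans (arr_prime d)

/-! ### The structure map turns operations on diagrams into operations of `Ψ`. -/

namespace TensorManifold

variable (A : TensorManifold.{u})

theorem unit_str : (unitMap A.A).comp A.str = TensorScheme.Hom.id A.A := A.unit

theorem assoc_str : (fissionMap (counitMap (aggregationObj A.A))).comp A.str =
    (fissionMap (aggregationMap A.str)).comp A.str := A.assoc

/-- The object part of the associativity law of the algebra: the counit of `F(D)` concatenates a
word of words. -/
theorem fuse_flatten (W : List (List A.A.Ob)) : A.fuse (W.map A.fuse) = A.fuse W.flatten := by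
  have h := congrArg (fun φ => TensorScheme.Hom.obj φ W) A.assoc_str
  rw [← tensorList_aggregation]
  exact h.symm

theorem fuse_append (w v : List A.A.Ob) : A.fuse [A.fuse w, A.fuse v] = A.fuse (w ++ v) := by
  simpa using A.fuse_flatten [w, v]

theorem arr_act_congr {w v w' v' : List A.A.Ob} {d : (aggregationObj A.A).Hom w v}
    {d' : (aggregationObj A.A).Hom w' v'}
    (h : (aggregationObj A.A).arr d = (aggregationObj A.A).arr d') :
    (psiData A).arr (A.act d) = (psiData A).arr (A.act d') := by
  unfold StrictTensorCat.arr at h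
  cases h
  rfl

theorem arr_strip {x y : A.A.Ob} (f : A.A.Mor [A.fuse [x]] [A.fuse [y]]) :
    (psiData A).arr (x := x) (y := y) (A.strip f) =
      (psiData A).arr (x := A.fuse [x]) (y := A.fuse [y]) f :=
  (psiData A).arr_congr (A.fuse_singleton x).symm (A.fuse_singleton y).symm
    (A.A.castMor_heq _ _ f)

/-- The unit law of the algebra, on morphisms. It makes every morphism of `Ψ(D, ε)` a value of
`act`, which is what lets the axioms descend from `F(D)`. -/
theorem arr_act_generator {x y : A.A.Ob} (f : A.A.Mor [x] [y]) :
    (psiData A).arr (A.act (generator f)) = (psiData A).arr (x := x) (y := y) f :=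
  (psiData A).arr_congr (A.fuse_singleton x) (A.fuse_singleton y)
    (((TensorScheme.Hom.comp_mor_heq (unitMap A.A) A.str f).symm.trans
      (TensorScheme.Hom.mor_heq_of_eq A.unit_str f)).trans (TensorScheme.Hom.id_mor_heq f))

/-- The associativity of the structure map, for prime diagrams with one input and one output. -/
theorem arr_act_act {W V : List (List A.A.Ob)}
    (d : (aggregationObj (fissionObj (aggregationObj A.A))).Hom W V) :
    (psiData A).arr (A.act ((aggregationMap A.str).map d)) =
      (psiData A).arr (A.act ((counitMap (aggregationObj A.A)).map d)) := by
  -- Both sides of the associativity law are evaluated at one prime diagram whose label is the whole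
  -- of `d`. One side substitutes the labels of the vertices of `d`, the other replaces each label
  -- by its value under the structure map.
  have key := TensorScheme.Hom.mor_heq_of_eq A.assoc_str (prime d)
  have h1 := (TensorScheme.Hom.comp_mor_heq (fissionMap (counitMap (aggregationObj A.A)))
    A.str (prime d)).symm.trans (key.trans (TensorScheme.Hom.comp_mor_heq _ _ _))
  have h2 : (fissionMap (counitMap (aggregationObj A.A))).mor (prime d) =
      prime ((counitMap (aggregationObj A.A)).map d) :=
    fissionMap_prime _ d
  have h3 : (fissionMap (aggregationMap A.str)).mor (prime d) =
      prime ((aggregationMap A.str).map d) :=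
    fissionMap_prime _ d
  rw [h2, h3] at h1
  refine (psiData A).arr_congr ?_ ?_ h1.symm
  · exact (A.fuse_flatten W).trans (congrArg A.fuse (tensorList_aggregation W).symm)
  · exact (A.fuse_flatten V).trans (congrArg A.fuse (tensorList_aggregation V).symm)

/-- A strand labelled by `ε(w)` is the relabelling of a strand labelled by the letter `w` of
`UF(D)`; substituting instead of relabelling gives the parallel strands of the word `w`. -/
theorem arr_id_fuse (w : List A.A.Ob) :
    (psiData A).arr ((psiData A).id (A.fuse w)) =
      (psiData A).arr (A.act ((aggregationObj A.A).id w)) := by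
  refine (A.arr_strip _).trans ((A.arr_act_act (W := [w]) (V := [w])
    ((aggregationObj (fissionObj (aggregationObj A.A))).id [w])).trans (A.arr_act_congr ?_))
  exact (aggregationObj A.A).arr_id ((aggregationObj A.A).tensorList_singleton w)

theorem arr_id (x : A.A.Ob) :
    (psiData A).arr ((psiData A).id x) =
      (psiData A).arr (A.act ((aggregationObj A.A).id [x])) := A.arr_strip _

/-- Associativity is applied to the diagram with two vertices, labelled by `d` and, below it, by
`e`. Relabelling by the structure map gives the diagram that defines composition in `Ψ`;
substitution gives the stack of `d` and `e`. -/
theorem arr_comp_act {w v z : List A.A.Ob} (d : (aggregationObj A.A).Hom w v)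
    (e : (aggregationObj A.A).Hom v z) :
    (psiData A).arr ((psiData A).comp (A.act d) (A.act e)) =
      (psiData A).arr (A.act ((aggregationObj A.A).comp d e)) := by
  refine (A.arr_strip _).trans ((A.arr_act_act
    ((aggregationObj (fissionObj (aggregationObj A.A))).comp (generator (prime d))
      (generator (prime e)))).trans (A.arr_act_congr ?_))
  rw [(counitMap (aggregationObj A.A)).isStrictFunctor.map_comp]
  exact (aggregationObj A.A).arr_comp_congr (arr_counitMap_prime d) (arr_counitMap_prime e)

theorem arr_tensor_act {w v w' v' : List A.A.Ob} (d : (aggregationObj A.A).Hom w v)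
    (e : (aggregationObj A.A).Hom w' v') :
    (psiData A).arr ((psiData A).tensor (A.act d) (A.act e)) =
      (psiData A).arr (A.act ((aggregationObj A.A).tensor d e)) := by
  refine (A.arr_act_act
    ((aggregationObj (fissionObj (aggregationObj A.A))).tensor (generator (prime d))
      (generator (prime e)))).trans (A.arr_act_congr ?_)
  -- The counit is a strict tensor functor, so on bundled arrows it is a monoid homomorphism for
  -- `⊗`.
  refine ((counitMap (aggregationObj A.A)).onArr.map_mul
    (StrictTensorCat.arr _ (generator (prime d)))
    (StrictTensorCat.arr _ (generator (prime e)))).trans ?_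
  exact congrArg₂ (· * ·) (arr_counitMap_prime d) (arr_counitMap_prime e)

/-! ### The axioms of a strict tensor category for `Ψ(D, ε)`. -/

variable {A}

/-- Builds a diagram representing a composite from diagrams representing its factors. Iterating this
and its tensor analogue turns each side of an axiom into `act` of a single diagram. -/
theorem arr_comp_of_act {x y z : (psiData A).Ob} {f : (psiData A).Hom x y}
    {g : (psiData A).Hom y z} {w v u : List A.A.Ob} {d : (aggregationObj A.A).Hom w v}
    {e : (aggregationObj A.A).Hom v u} (hf : (psiData A).arr (A.act d) = (psiData A).arr f)
    (hg : (psiData A).arr (A.act e) = (psiData A).arr g) :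
    (psiData A).arr (A.act ((aggregationObj A.A).comp d e)) =
      (psiData A).arr ((psiData A).comp f g) :=
  (A.arr_comp_act d e).symm.trans ((psiData A).arr_comp_congr hf hg)

theorem arr_tensor_of_act {x y z t : (psiData A).Ob} {f : (psiData A).Hom x y}
    {g : (psiData A).Hom z t} {w v w' v' : List A.A.Ob} {d : (aggregationObj A.A).Hom w v}
    {e : (aggregationObj A.A).Hom w' v'} (hf : (psiData A).arr (A.act d) = (psiData A).arr f)
    (hg : (psiData A).arr (A.act e) = (psiData A).arr g) :
    (psiData A).arr (A.act ((aggregationObj A.A).tensor d e)) =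
      (psiData A).arr ((psiData A).tensor f g) :=
  (A.arr_tensor_act d e).symm.trans ((psiData A).arr_tensor_congr hf hg)

theorem psiData_isStrict (A : TensorManifold.{u}) : (psiData A).IsStrict where
  id_comp {x y} f := by
    refine (psiData A).arr_inj ((arr_comp_of_act (A.arr_id x).symm
      (A.arr_act_generator f)).symm.trans ?_)
    rw [(aggregationObj A.A).isStrict.id_comp]
    exact A.arr_act_generator f
  comp_id {x y} f := by
    refine (psiData A).arr_inj ((arr_comp_of_act (A.arr_act_generator f)
      (A.arr_id y).symm).symm.trans ?_)
    rw [(aggregationObj A.A).isStrict.comp_id]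
    exact A.arr_act_generator f
  comp_assoc f g h := by
    have hf := A.arr_act_generator f
    have hg := A.arr_act_generator g
    have hh := A.arr_act_generator h
    refine (psiData A).arr_inj ((arr_comp_of_act (arr_comp_of_act hf hg) hh).symm.trans
      (Eq.trans ?_ (arr_comp_of_act hf (arr_comp_of_act hg hh))))
    rw [(aggregationObj A.A).isStrict.comp_assoc]
  -- In `F(D)` the juxtaposition of the strands `x` and `y` is by definition the identity of the
  -- word `xy`.
  tensor_id x y := (psiData A).arr_inj ((arr_tensor_of_act (A.arr_id x).symm
    (A.arr_id y).symm).symm.trans (A.arr_id_fuse [x, y]).symm)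
  tensor_comp f g f' g' := by
    have hf := A.arr_act_generator f
    have hg := A.arr_act_generator g
    have hf' := A.arr_act_generator f'
    have hg' := A.arr_act_generator g'
    refine (psiData A).arr_inj ((arr_tensor_of_act (arr_comp_of_act hf hg)
      (arr_comp_of_act hf' hg')).symm.trans (Eq.trans ?_
        (arr_comp_of_act (arr_tensor_of_act hf hf') (arr_tensor_of_act hg hg'))))
    rw [(aggregationObj A.A).isStrict.tensor_comp]
  tensorObj_assoc x y z :=
    -- A bare letter is rewritten as the value of its one-letter word, so that both bracketings
    -- become the value of the word `xyz`.
    (congrArg (fun t => A.fuse [A.fuse [x, y], t]) (A.fuse_singleton z)).symm.trans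
      ((A.fuse_append [x, y] [z]).trans ((A.fuse_append [x] [y, z]).symm.trans
        (congrArg (fun t => A.fuse [t, A.fuse [y, z]]) (A.fuse_singleton x))))
  unit_tensorObj x :=
    (congrArg (fun t => A.fuse [A.fuse [], t]) (A.fuse_singleton x)).symm.trans
      ((A.fuse_append [] [x]).trans (A.fuse_singleton x))
  tensorObj_unit x :=
    (congrArg (fun t => A.fuse [t, A.fuse []]) (A.fuse_singleton x)).symm.trans
      ((A.fuse_append [x] []).trans (A.fuse_singleton x))
  tensor_assoc f g h := by
    have hf := A.arr_act_generator f
    have hg := A.arr_act_generator g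
    have hh := A.arr_act_generator h
    refine (psiData A).heq_of_arr ((arr_tensor_of_act (arr_tensor_of_act hf hg) hh).symm.trans
      (Eq.trans ?_ (arr_tensor_of_act hf (arr_tensor_of_act hg hh))))
    exact A.arr_act_congr
      (mul_assoc (StrictTensorCat.arr _ (generator f)) (StrictTensorCat.arr _ (generator g))
        (StrictTensorCat.arr _ (generator h)))
  unit_tensor f := by
    have hf := A.arr_act_generator f
    refine (psiData A).heq_of_arr
      -- The unit object is the value of the empty word, so its identity is represented by the empty
      -- diagram, which is neutral for juxtaposition.
      ((arr_tensor_of_act (A.arr_id_fuse []).symm hf).symm.trans (Eq.trans ?_ hf))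
    exact A.arr_act_congr (one_mul (StrictTensorCat.arr _ (generator f)))
  tensor_unit f := by
    have hf := A.arr_act_generator f
    refine (psiData A).heq_of_arr
      ((arr_tensor_of_act hf (A.arr_id_fuse []).symm).symm.trans (Eq.trans ?_ hf))
    exact A.arr_act_congr (mul_one (StrictTensorCat.arr _ (generator f)))

/-! ### Morphisms of tensor manifolds give strict tensor functors. -/

theorem str_comp {A B : TensorManifold.{u}} (φ : A ⟶ B) :
    (fissionMap (aggregationMap φ.f)).comp B.str = A.str.comp φ.f := φ.h

theorem map_fuse {A B : TensorManifold.{u}} (φ : A ⟶ B) (w : List A.A.Ob) :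
    φ.f.obj (A.fuse w) = B.fuse (w.map φ.f.obj) :=
  (congrArg (fun ψ : TensorScheme.Hom (fissionObj (aggregationObj A.A)) B.A => ψ.obj w)
    (str_comp φ)).symm

/-- The algebra-morphism square, evaluated at the prime diagram labelled by `d`. Since the
operations of `Ψ` are values of `act` on diagrams that `F(φ)` preserves, functoriality follows from
it. -/
theorem arr_map_act {A B : TensorManifold.{u}} (φ : A ⟶ B) {w v : List A.A.Ob}
    (d : (aggregationObj A.A).Hom w v) :
    (psiData B).arr ((psiMap φ).map (A.act d)) =
      (psiData B).arr (B.act ((aggregationMap φ.f).map d)) := by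
  have h1 := (TensorScheme.Hom.comp_mor_heq A.str φ.f (prime d)).symm.trans
    ((TensorScheme.Hom.mor_heq_of_eq (str_comp φ) (prime d)).symm.trans
      (TensorScheme.Hom.comp_mor_heq _ _ _))
  have h2 : (fissionMap (aggregationMap φ.f)).mor (prime d) =
      prime ((aggregationMap φ.f).map d) :=
    fissionMap_prime _ d
  rw [h2] at h1
  exact (psiData B).arr_congr (map_fuse φ w) (map_fuse φ v) h1

theorem arr_map_congr {A B : TensorManifold.{u}} (φ : A ⟶ B) {x y x' y' : (psiData A).Ob}
    {f : (psiData A).Hom x y} {f' : (psiData A).Hom x' y'}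
    (h : (psiData A).arr f = (psiData A).arr f') :
    (psiData B).arr ((psiMap φ).map f) = (psiData B).arr ((psiMap φ).map f') := by
  unfold TensorData.arr at h
  cases h
  rfl

theorem psiMap_isStrictFunctor {A B : TensorManifold.{u}} (φ : A ⟶ B) :
    (psiMap φ).IsStrictFunctor where
  map_id x := (psiData B).arr_inj ((arr_map_congr φ (A.arr_id x)).trans
    ((arr_map_act φ _).trans (B.arr_id _).symm))
  map_comp _ _ := (psiData B).arr_inj ((arr_map_congr φ (A.arr_strip _)).trans
    ((arr_map_act φ _).trans (B.arr_strip _).symm))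
  obj_unit := map_fuse φ []
  obj_tensor x y := map_fuse φ [x, y]
  map_tensor _ _ := (psiData B).heq_of_arr (arr_map_act φ _)

end TensorManifold

/-! ### Strict tensor functors that are identities up to transport. -/

namespace StrictTensorCat

/-- Once both maps of `K` are replaced by identities, the functor axioms of `K` say exactly that the
operations of `V` and `W` coincide; the remaining fields are proofs. -/
theorem eq_of_heq_map {V W : StrictTensorCat.{u}} (K : Functor V W) (hO : V.Ob = W.Ob)
    (hobj : ∀ x, HEq (K.obj x) x) (hH : ∀ x y, V.Hom x y = W.Hom (K.obj x) (K.obj y))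
    (hmap : ∀ {x y} (f : V.Hom x y), HEq (K.map f) f) : V = W := by
  obtain ⟨⟨O, H, u, t, i, c, m⟩, hV⟩ := V
  obtain ⟨⟨O', H', u', t', i', c', m'⟩, hW⟩ := W
  obtain ⟨⟨o, k⟩, hK⟩ := K
  dsimp only at hO
  subst hO
  obtain rfl : o = fun x => x := funext fun x => eq_of_heq (hobj x)
  obtain rfl : H = H' := funext fun x => funext fun y => hH x y
  obtain rfl : @k = fun _ _ f => f :=
    funext fun x => funext fun y => funext fun f => eq_of_heq (hmap f)
  obtain rfl : u = u' := hK.obj_unit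
  obtain rfl : t = t' := funext fun x => funext fun y => hK.obj_tensor x y
  obtain rfl : i = i' := funext fun x => hK.map_id x
  obtain rfl : @c = @c' := by
    funext x y z f g
    exact hK.map_comp f g
  obtain rfl : @m = @m' := by
    funext x y z w f g
    exact eq_of_heq (hK.map_tensor f g)
  rfl

theorem isIso_of_heq_map {V W : StrictTensorCat.{u}} (K : Functor V W)
    (hO : V.Ob = W.Ob) (hobj : ∀ x, HEq (K.obj x) x)
    (hH : ∀ x y, V.Hom x y = W.Hom (K.obj x) (K.obj y))
    (hmap : ∀ {x y} (f : V.Hom x y), HEq (K.map f) f) :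
    IsIso (C := StrictTensorCat.{u}) K := by
  obtain rfl : V = W := eq_of_heq_map K hO hobj hH hmap
  obtain rfl : K = 𝟙 V := Functor.ext_heq (fun x => eq_of_heq (hobj x)) hmap
  exact inferInstanceAs (IsIso (𝟙 V))

end StrictTensorCat

/-! ### The identification of `ΨΦ(V)` with `V`. -/

section Comparison

variable (V : StrictTensorCat.{u})

/-- The structure map of `Φ(V)` is `U` of the counit, so `act` there is evaluation of diagrams in
`V`. -/
theorem arr_comparison_act {w v : List V.Ob} (d : (aggregationObj (fissionObj V)).Hom w v) :
    V.arr (x := V.tensorList [V.tensorList w]) (y := V.tensorList [V.tensorList v])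
      (TensorManifold.act (comparison.obj V) d) = V.arr ((counitMap V).map d) := by
  refine V.arr_congr (V.tensorList_singleton _) (V.tensorList_singleton _)
    ((fissionMap_mor_heq (counitMap V) (prime d)).trans ?_)
  exact (counitMap V).map_heq ((aggregationObj (fissionObj V)).tensorList_singleton w)
    ((aggregationObj (fissionObj V)).tensorList_singleton v)
    ((aggregationObj (fissionObj V)).castHom_heq _ _ d)

theorem arr_comparison_strip {x y : V.Ob}
    (f : V.Hom (V.tensorList [V.tensorList [x]]) (V.tensorList [V.tensorList [y]])) :
    V.arr (x := V.tensorList [x]) (y := V.tensorList [y])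
      (TensorManifold.strip (comparison.obj V) f) = V.arr f :=
  V.arr_congr (congrArg (fun z => V.tensorList [z]) (V.tensorList_singleton x)).symm
    (congrArg (fun z => V.tensorList [z]) (V.tensorList_singleton y)).symm
    ((fissionObj V).castMor_heq _ _ _)

theorem arr_castHom_singleton {x y : V.Ob} (f : V.Hom (V.tensorList [x]) (V.tensorList [y])) :
    V.arr (V.castHom (V.tensorList_singleton x) (V.tensorList_singleton y) f) = V.arr f :=
  V.arr_castHom _ _ f

/-- The canonical strict tensor functor `ΨΦ(V) ⟶ V`. -/
def unpack : StrictTensorCat.Functor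
    ⟨psiData (comparison.obj V), TensorManifold.psiData_isStrict _⟩ V where
  obj x := x
  map {x y} f := V.castHom (V.tensorList_singleton x) (V.tensorList_singleton y) f
  isStrictFunctor :=
    { map_id := fun x => V.arr_inj <| (arr_castHom_singleton V _).trans <|
        (arr_comparison_strip V _).trans <| (arr_comparison_act V _).trans <|
        V.arr_id (V.tensorList_singleton x)
      map_comp := fun f g => V.arr_inj <| (arr_castHom_singleton V _).trans <|
        (arr_comparison_strip V _).trans <| (arr_comparison_act V _).trans <|
        (congrArg V.arr ((counitMap V).isStrictFunctor.map_comp _ _)).trans <|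
        V.arr_comp_congr ((counitMap_generator V f).trans (arr_castHom_singleton V _).symm)
          ((counitMap_generator V g).trans (arr_castHom_singleton V _).symm)
      obj_unit := rfl
      -- The product in `ΨΦ(V)` is the right-nested product of the word `xy`, that is `x ⊗ (y ⊗ I)`.
      obj_tensor := fun x y => congrArg (V.tensorObj x) (V.tensorList_singleton y)
      map_tensor := fun f g => V.heq_of_arr <| (arr_castHom_singleton V _).trans <|
        (arr_comparison_act V _).trans <|
        ((counitMap V).onArr.map_mul (StrictTensorCat.arr _ (generator f))
          (StrictTensorCat.arr _ (generator g))).trans <| congrArg₂ (· * ·)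
            ((counitMap_generator V f).trans (arr_castHom_singleton V _).symm)
            ((counitMap_generator V g).trans (arr_castHom_singleton V _).symm) }

theorem unpack_map_heq {x y : V.Ob} (f : (psiData (comparison.obj V)).Hom x y) :
    HEq ((unpack V).map f) f :=
  V.castHom_heq (V.tensorList_singleton x) (V.tensorList_singleton y) f

theorem psi_comparison_eq :
    (⟨psiData (comparison.obj V), TensorManifold.psiData_isStrict _⟩ : StrictTensorCat.{u}) = V :=
  StrictTensorCat.eq_of_heq_map (unpack V) rfl (fun _ => HEq.rfl)
    (fun x y => congrArg₂ V.Hom (V.tensorList_singleton x) (V.tensorList_singleton y))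
    (unpack_map_heq V)

theorem isIso_unpack : IsIso (C := StrictTensorCat.{u})
    (X := ⟨psiData (comparison.obj V), TensorManifold.psiData_isStrict _⟩) (Y := V) (unpack V) :=
  StrictTensorCat.isIso_of_heq_map (unpack V) rfl (fun _ => HEq.rfl)
    (fun x y => congrArg₂ V.Hom (V.tensorList_singleton x) (V.tensorList_singleton y))
    (unpack_map_heq V)

end Comparison

/-- The isomorphism `Ψ ∘ Φ ≅ Id`. -/
noncomputable def comparisonPsiIso :
    comparison.{u} ⋙ psi TensorManifold.psiData_isStrict TensorManifold.psiMap_isStrictFunctor ≅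
      𝟭 StrictTensorCat.{u} :=
  NatIso.ofComponents (fun V => @asIso _ _ _ _ (unpack V) (isIso_unpack V)) fun {V W} K =>
    StrictTensorCat.Functor.ext_heq (fun _ => rfl) fun {x y} f =>
      (unpack_map_heq W _).trans <| (fissionMap_mor_heq K (xs := [x]) (ys := [y]) f).trans <|
        K.map_heq (V.tensorList_singleton x) (V.tensorList_singleton y)
          (unpack_map_heq V f).symm

/-! ### The comparison functor is an embedding. -/

theorem comparison_obj_injective : Function.Injective comparison.{u}.obj := fun V W h => by
  -- An equality `ΨΦ(V) = V` is needed here: an isomorphism would recover `V` only up to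
  -- isomorphism.
  rw [← psi_comparison_eq V, ← psi_comparison_eq W]
  simp only [h]

/-- A morphism of tensor manifolds between values of `Φ` does not depend on the factorizations of
the source and the target of a morphism. -/
theorem comparison_hom_mor_heq {V W : StrictTensorCat.{u}}
    (φ : comparison.obj V ⟶ comparison.obj W) {xs ys : List V.Ob}
    (f : (fissionObj V).Mor xs ys)
    {f' : (fissionObj V).Mor [V.tensorList xs] [V.tensorList ys]} (hf : HEq f' f) :
    HEq (TensorScheme.Hom.mor φ.f f') (TensorScheme.Hom.mor φ.f f) := by
  -- The one-letter version of `f` is the value of the one-vertex diagram labelled by `f`. As `φ`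
  -- commutes with the structure maps, its image is the value of the one-vertex diagram labelled by
  -- `φ(f)`, which is `φ(f)` itself.
  have h1 : f' = TensorManifold.act (comparison.obj V) (generator f) :=
    eq_of_heq (hf.trans (V.heq_of_arr
      ((arr_comparison_act V (generator f)).trans (counitMap_generator V f))).symm)
  have h2 := (psiData (comparison.obj W)).heq_of_arr (TensorManifold.arr_map_act φ (generator f))
  rw [h1]
  exact h2.trans (W.heq_of_arr ((arr_comparison_act W
    (generator (TensorScheme.Hom.mor φ.f f))).trans (counitMap_generator W _)))

theorem StrictTensorCat.Functor.map_heq_of_eq {V W : StrictTensorCat.{u}}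
    {K L : StrictTensorCat.Functor V W} (h : K = L) {x y : V.Ob} (f : V.Hom x y) :
    HEq (K.map f) (L.map f) := by
  subst h
  rfl

theorem comparison_full : comparison.{u}.Full where
  map_surjective {V W} φ := by
    let L : StrictTensorCat.Functor
        ⟨psiData (comparison.obj V), TensorManifold.psiData_isStrict _⟩ W :=
      StrictTensorCat.Functor.comp
        ⟨psiMap φ, TensorManifold.psiMap_isStrictFunctor φ⟩ (unpack W)
    -- The witness is the inverse of `unpack V` followed by `L`.
    obtain ⟨K, hK⟩ : ∃ K : StrictTensorCat.Functor V W, (unpack V).comp K = L :=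
      ⟨_, @IsIso.hom_inv_id_assoc StrictTensorCat.{u} _ _ V (unpack V) (isIso_unpack V) W L⟩
    have hobj : ∀ x, K.obj x = TensorScheme.Hom.obj φ.f x := fun x =>
      congrArg (fun M : StrictTensorCat.Functor
        ⟨psiData (comparison.obj V), TensorManifold.psiData_isStrict _⟩ W => M.obj x) hK
    refine ⟨K, Monad.Algebra.Hom.ext (TensorScheme.Hom.ext_heq hobj fun xs ys f => ?_)⟩
    -- The equation `hK` controls `K` only through morphisms between one-letter words, so `f` is
    -- first moved to the letters `⊗xs` and `⊗ys`.
    let g : V.Hom (V.tensorList [V.tensorList xs]) (V.tensorList [V.tensorList ys]) :=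
      V.castHom (V.tensorList_singleton _).symm (V.tensorList_singleton _).symm f
    have hg : HEq g f := V.castHom_heq _ _ _
    refine (fissionMap_mor_heq K f).trans ?_
    refine HEq.trans ?_ (comparison_hom_mor_heq φ f hg)
    have h1 : (unpack V).map g = f := eq_of_heq ((unpack_map_heq V g).trans hg)
    have h2 := StrictTensorCat.Functor.map_heq_of_eq hK g
    change HEq (K.map ((unpack V).map g)) _ at h2
    rw [h1] at h2
    exact h2.trans (unpack_map_heq W _)

end TensorCalculus

theorem theorem6p3p1 :
    TensorCalculus.comparison.{u}.Full ∧
    TensorCalculus.comparison.{u}.Faithful ∧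
    Function.Injective TensorCalculus.comparison.{u}.obj ∧
    ∃ (h₁ : ∀ A : TensorCalculus.TensorManifold.{u}, (TensorCalculus.psiData A).IsStrict)
      (h₂ : ∀ {A B : TensorCalculus.TensorManifold.{u}} (φ : A ⟶ B),
        (TensorCalculus.psiMap φ).IsStrictFunctor),
      Nonempty (TensorCalculus.comparison.{u} ⋙ TensorCalculus.psi h₁ h₂ ≅
        𝟭 TensorCalculus.StrictTensorCat.{u}) :=
  ⟨TensorCalculus.comparison_full,
    -- `Φ` followed by `Ψ` is isomorphic to the identity, which is faithful, so `Φ` is faithful.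
    CategoryTheory.Functor.Faithful.of_comp_iso TensorCalculus.comparisonPsiIso,
    TensorCalculus.comparison_obj_injective,
    TensorCalculus.TensorManifold.psiData_isStrict,
    TensorCalculus.TensorManifold.psiMap_isStrictFunctor,
    ⟨TensorCalculus.comparisonPsiIso⟩⟩
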